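/- Let $F(z)$ be an $n\times n$ matrix valued meromorphic function in $\mathbb{C}$ which is analytic at $0$ and satisfies $\det F(0)\neq 0$. Terminology. A point $z_0$ is a pole of $F$ if it is a pole of some entry of $F$. Near any $z_0$, write $F(z)=M(z)\,\mathrm{diag}((z-z_0)^{r_1},\dots,(z-z_0)^{r_n})\,N(z)$ with $M,N$ analytic and invertible at $z_0$ and integers $r_1\le\dots\le r_n$; the numbers $|r_j|$ with $r_j<0$ are the partial pole multiplicities of $F$ at $z_0$. A nonzero $v\in\mathbb{C}^n$ is a pole vector of $F$ at $z_0$ if there is a power series $V(z)=v+\sum_{j\ge1}v_{j+1}(z-z_0)^j$, convergent near $z_0$, such that $F(z)^{-1}V(z)$ is analytic at $z_0$ and vanishes at $z_0$. (1) There exist nonzero complex numbers $z_k$ ($k\ge1$) with $|z_k|\to\infty$, orthogonal projection matrices $P_k$ ($P_k=0$ allowed, so that finite products are included), and $n\times n$ matrix valued entire functions $P$ and $G$ such that $$P(z)=\lim_{k\to\infty}E_k(z)E_{k-1}(z)\cdots E_1(z),\qquad E_k(z)=\exp\Big(\frac{z}{z_k}P_k+\dots+\frac1k\frac{z^k}{z_k^k}P_k\Big)\Big(I_n-\frac{z}{z_k}P_k\Big),$$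 uniformly on every bounded set with respect to the operator norm, and $$G(z)=P(z)F(z).$$ Moreover, with $F_0=F$ and $F_k=E_kF_{k-1}$, for every $k\ge1$: if $F_{k-1}$ has a pole, then $z_k$ is a pole of $F_{k-1}$; $P_k$ is the orthogonal projection onto the linear span of the pole vectors of $F_{k-1}$ at $z_k$ (so $P_k=0$ if $F_{k-1}$ has no pole); and the partial pole multiplicities at $z_k$ of $(I_n-\frac{z}{z_k}P_k)F_{k-1}(z)$, and likewise those of $F_k$, are exactly the nonzero numbers among $\mu_1-1,\dots,\mu_l-1$, where $\mu_1,\dots,\mu_l$ are those of $F_{k-1}$ at $z_k$. (2) For every pole $p$ of $F$, if $Q$ is the orthogonal projection onto the linear span of the pole vectors of $F$ at $p$, then the partial pole multiplicities of $(I_n-\frac{z}{p}Q)F(z)$ at $p$ are exactly the nonzero numbers among $\mu_1-1,\dots,\mu_l-1$, where $\mu_1,\dots,\mu_l$ are those of $F$ at $p$. -/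

import Mathlib

open Filter Topology
open scoped Matrix.Norms.L2Operator

noncomputable section

namespace MatFact

variable {n : ℕ}

/-- The matrix function `F` is analytic at `z₀`: all its entries are. -/
def IsAnalyticAt (F : ℂ → Matrix (Fin n) (Fin n) ℂ) (z₀ : ℂ) : Prop :=
  ∀ i j, AnalyticAt ℂ (fun z => F z i j) z₀

/-- The matrix function `F` is entire: all its entries are. -/
def IsEntire (F : ℂ → Matrix (Fin n) (Fin n) ℂ) : Prop :=
  ∀ i j, Differentiable ℂ (fun z => F z i j)

/-- The matrix function `F` is meromorphic in `ℂ`: all its entries are. -/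
def IsMeromorphic (F : ℂ → Matrix (Fin n) (Fin n) ℂ) : Prop :=
  ∀ i j, Meromorphic (fun z => F z i j)

/-- `z₀` is a pole of `F`: it is a pole of one of the entries of `F`. -/
def IsPole (F : ℂ → Matrix (Fin n) (Fin n) ℂ) (z₀ : ℂ) : Prop :=
  ∃ i j, meromorphicOrderAt (fun z => F z i j) z₀ < 0

/-- `v` is a pole vector of `F` at `z₀`: it is nonzero and there is a (convergent) power series
`V z = v + v₂ (z - z₀) + v₃ (z - z₀)² + ⋯`, that is, a function `V` analytic at `z₀` with
`V z₀ = v`, such that `F(z)⁻¹ V(z)` is analytic at `z₀` (after removal of the singularity) and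
has a zero at `z₀`. -/
def IsPoleVector (F : ℂ → Matrix (Fin n) (Fin n) ℂ) (z₀ : ℂ) (v : Fin n → ℂ) : Prop :=
  v ≠ 0 ∧ ∃ V H : ℂ → Fin n → ℂ,
    AnalyticAt ℂ V z₀ ∧ V z₀ = v ∧ AnalyticAt ℂ H z₀ ∧ H z₀ = 0 ∧
      ∀ᶠ z in 𝓝[≠] z₀, (F z)⁻¹.mulVec (V z) = H z

/-- The linear span of the pole vectors of `F` at `z₀`. -/
def poleSpace (F : ℂ → Matrix (Fin n) (Fin n) ℂ) (z₀ : ℂ) : Submodule ℂ (Fin n → ℂ) :=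
  Submodule.span ℂ {v | IsPoleVector F z₀ v}

/-- `Q` is the matrix of the orthogonal projection of `ℂⁿ` onto the subspace `S`. -/
def IsOrthogonalProjectionOnto (Q : Matrix (Fin n) (Fin n) ℂ)
    (S : Submodule ℂ (Fin n → ℂ)) : Prop :=
  IsStarProjection Q ∧ LinearMap.range Q.mulVecLin = S

/-- Near `z₀`, `F(z) = M(z) diag((z - z₀)^{r₁}, …, (z - z₀)^{rₙ}) N(z)` with `M`, `N` analytic
and invertible at `z₀` and integers `r₁ ≤ ⋯ ≤ rₙ`. -/
def HasLocalForm (F : ℂ → Matrix (Fin n) (Fin n) ℂ) (z₀ : ℂ) (r : Fin n → ℤ) : Prop :=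
  Monotone r ∧ ∃ M N : ℂ → Matrix (Fin n) (Fin n) ℂ,
    IsAnalyticAt M z₀ ∧ IsAnalyticAt N z₀ ∧ (M z₀).det ≠ 0 ∧ (N z₀).det ≠ 0 ∧
      ∀ᶠ z in 𝓝[≠] z₀, F z = M z * Matrix.diagonal (fun j => (z - z₀) ^ r j) * N z

/-- The partial pole multiplicities of `F` at `z₀` (listed with repetitions) form the multiset
`m`: these are the numbers `|r_j|` with `r_j < 0` in the local form of `F` at `z₀`. -/
def HasPartialPoleMultiplicities (F : ℂ → Matrix (Fin n) (Fin n) ℂ) (z₀ : ℂ)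
    (m : Multiset ℕ) : Prop :=
  ∃ r : Fin n → ℤ, HasLocalForm F z₀ r ∧
    m = (Finset.univ.filter (fun j => r j < 0)).val.map (fun j => (r j).natAbs)

/-- Lower every member of a multiset by one, and drop the zeros. -/
def lowerByOne (m : Multiset ℕ) : Multiset ℕ :=
  (m.map (fun k => k - 1)).filter (fun k => k ≠ 0)

/-- `F` has partial pole multiplicities at `z₀`, and `F'` has as its partial pole multiplicities
at `z₀` exactly those of `F` lowered by one (with zeros dropped). -/
def PoleMultiplicitiesLowered (F F' : ℂ → Matrix (Fin n) (Fin n) ℂ) (z₀ : ℂ) : Prop :=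
  (∃ m, HasPartialPoleMultiplicities F z₀ m) ∧
    ∀ m, HasPartialPoleMultiplicities F z₀ m →
      ∀ m', HasPartialPoleMultiplicities F' z₀ m' ↔ m' = lowerByOne m

/-- The factor `I - (z / w) Q`. -/
def linearFactor (w : ℂ) (Q : Matrix (Fin n) (Fin n) ℂ) (z : ℂ) : Matrix (Fin n) (Fin n) ℂ :=
  1 - (z / w) • Q

/-- `exp((z/w) Q + (1/2) (z/w)² Q + ⋯ + (1/k) (z/w)ᵏ Q) (I - (z/w) Q)`. -/
def primaryFactor (k : ℕ) (w : ℂ) (Q : Matrix (Fin n) (Fin n) ℂ) (z : ℂ) :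
    Matrix (Fin n) (Fin n) ℂ :=
  NormedSpace.exp (∑ j ∈ Finset.Icc 1 k, ((1 / (j : ℂ)) * (z ^ j / w ^ j)) • Q) *
    linearFactor w Q z

/-- The product of the first `k` factors, the newest one on the left. The sequences are indexed
from `0`, so that `w k`, `Q k` belong to factor number `k + 1`. -/
def partialProduct (w : ℕ → ℂ) (Q : ℕ → Matrix (Fin n) (Fin n) ℂ) :
    ℕ → ℂ → Matrix (Fin n) (Fin n) ℂ
  | 0, _ => 1
  | k + 1, z => primaryFactor (k + 1) (w k) (Q k) z * partialProduct w Q k z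

/-- The product of the first `k` factors, multiplied by `F`. -/
def stage (w : ℕ → ℂ) (Q : ℕ → Matrix (Fin n) (Fin n) ℂ) (F : ℂ → Matrix (Fin n) (Fin n) ℂ)
    (k : ℕ) (z : ℂ) : Matrix (Fin n) (Fin n) ℂ :=
  partialProduct w Q k z * F z

/-- `P` is the infinite product with points `w k` and projections `Q k`: the `w k` are nonzero and
tend to infinity, the `Q k` are orthogonal projection matrices, and the partial products
converge to `P` in the operator norm, uniformly on every bounded set. Finite products are
those with `Q k = 0` from some index on, since the factor of the zero projection is `I`. -/
structure IsProduct (P : ℂ → Matrix (Fin n) (Fin n) ℂ) (w : ℕ → ℂ)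
    (Q : ℕ → Matrix (Fin n) (Fin n) ℂ) : Prop where
  ne_zero : ∀ k, w k ≠ 0
  tendsto_norm : Tendsto (fun k => ‖w k‖) atTop atTop
  projection : ∀ k, IsStarProjection (Q k)
  tendsto : ∀ B : Set ℂ, Bornology.IsBounded B →
    TendstoUniformlyOn (partialProduct w Q) P atTop B

end MatFact

end

/-! Near a pole write F = M D N with D a diagonal matrix of powers. The columns of M(z₀) with
negative exponent are pole vectors, and a pole vector has no component along the other columns. So
the pole space is the range of the oblique projection Q' = M(z₀) J M(z₀)⁻¹, where J is the
coordinate projection onto the negative exponents. The orthogonal projection Q has the same range,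
that is, QQ' = Q' and Q'Q = Q. These identities alone let the linear factor pass through M
(`exists_pencil_mul_eq`): (I - (z/z₀)Q) M = B (I - (z/z₀)J) with B analytic and invertible at z₀.
The factor with J merges with D and raises each negative exponent by one
(`HasLocalForm.linearFactor_mul`). The exponential is invertible and changes no exponent. Gaussian
elimination with a pivot of least order gives a local form (`exists_hasLocalForm`), and
`HasLocalForm.unique` makes the multiplicities well defined.

Globally this step is iterated at a pole of least modulus. Each factor is entire, and invertible
away from its point, so no pole is created, and the total multiplicity in a disc drops as long as
the disc contains a pole. Hence every disc is cleared after finitely many steps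
(`Admissible.exists_forall_not_isPole`), and the points tend to infinity. Orthogonal projections
have norm at most 1, so a primary factor is no further from I than the scalar Weierstrass factor is
from 1; this gives a summable bound on every disc and an entire product P. On a given disc, PF is an
entire tail of the product times a stage without poles there, so PF extends to an entire G. -/

namespace MatFact

variable {n : ℕ} {F A B : ℂ → Matrix (Fin n) (Fin n) ℂ} {z₀ : ℂ}

/-! ### Matrix functions analytic at a point -/

lemma IsAnalyticAt.const (C : Matrix (Fin n) (Fin n) ℂ) : IsAnalyticAt (fun _ => C) z₀ :=
  fun _ _ => analyticAt_const

lemma IsAnalyticAt.mul (hA : IsAnalyticAt A z₀) (hB : IsAnalyticAt B z₀) :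
    IsAnalyticAt (fun z => A z * B z) z₀ := by
  intro i j
  simp only [Matrix.mul_apply]
  exact Finset.analyticAt_fun_sum _ fun k _ => (hA i k).mul (hB k j)

lemma IsAnalyticAt.add (hA : IsAnalyticAt A z₀) (hB : IsAnalyticAt B z₀) :
    IsAnalyticAt (fun z => A z + B z) z₀ :=
  fun i j => (hA i j).add (hB i j)

lemma IsAnalyticAt.smul {f : ℂ → ℂ} (hf : AnalyticAt ℂ f z₀) (hA : IsAnalyticAt A z₀) :
    IsAnalyticAt (fun z => f z • A z) z₀ :=
  fun i j => hf.mul (hA i j)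

lemma IsAnalyticAt.det (hA : IsAnalyticAt A z₀) : AnalyticAt ℂ (fun z => (A z).det) z₀ := by
  simp only [Matrix.det_apply']
  exact Finset.analyticAt_fun_sum _ fun σ _ =>
    analyticAt_const.mul (Finset.analyticAt_fun_prod _ fun i _ => hA _ _)

lemma IsAnalyticAt.adjugate (hA : IsAnalyticAt A z₀) :
    IsAnalyticAt (fun z => (A z).adjugate) z₀ := by
  intro i j
  simp only [Matrix.adjugate_apply]
  refine IsAnalyticAt.det (A := fun z => (A z).updateRow j (Pi.single i 1)) fun k l => ?_
  by_cases h : k = j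
  · simp only [h, Matrix.updateRow_self]
    exact analyticAt_const
  · simp only [Matrix.updateRow_ne h]
    exact hA k l

lemma IsAnalyticAt.inv (hA : IsAnalyticAt A z₀) (h : (A z₀).det ≠ 0) :
    IsAnalyticAt (fun z => (A z)⁻¹) z₀ := by
  simp only [Matrix.inv_def, Ring.inverse_eq_inv']
  exact IsAnalyticAt.smul (hA.det.inv h) hA.adjugate

lemma IsAnalyticAt.eventually_det_ne_zero (hA : IsAnalyticAt A z₀) (h : (A z₀).det ≠ 0) :
    ∀ᶠ z in 𝓝 z₀, (A z).det ≠ 0 :=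
  hA.det.continuousAt.eventually_ne h

lemma IsAnalyticAt.mulVec (hA : IsAnalyticAt A z₀) {v : ℂ → Fin n → ℂ} (hv : AnalyticAt ℂ v z₀) :
    AnalyticAt ℂ (fun z => (A z).mulVec (v z)) z₀ := by
  rw [analyticAt_pi_iff] at hv ⊢
  intro i
  simp only [Matrix.mulVec, dotProduct]
  exact Finset.analyticAt_fun_sum _ fun k _ => (hA i k).mul (hv k)

lemma IsEntire.isAnalyticAt (hA : IsEntire A) (z : ℂ) : IsAnalyticAt A z :=
  fun i j => (hA i j).analyticAt z

/-- A function analytic at `z₀` is its value at `z₀` plus `z - z₀` times an analytic function. -/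
lemma _root_.AnalyticAt.exists_eq_add_sub_mul {f : ℂ → ℂ} (hf : AnalyticAt ℂ f z₀) :
    ∃ g : ℂ → ℂ, AnalyticAt ℂ g z₀ ∧ ∀ z, f z = f z₀ + (z - z₀) * g z := by
  obtain ⟨p, hp⟩ := hf
  refine ⟨dslope f z₀, ⟨_, hp.has_fpower_series_dslope_fslope⟩, fun z => ?_⟩
  have := sub_smul_dslope f z₀ z
  simp only [smul_eq_mul] at this
  rw [this]; ring

/-- A meromorphic function whose order is nonnegative agrees with an analytic function near the
point. -/
lemma _root_.MeromorphicAt.exists_analyticAt {f : ℂ → ℂ} (hf : MeromorphicAt f z₀)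
    (h : 0 ≤ meromorphicOrderAt f z₀) : ∃ g : ℂ → ℂ, AnalyticAt ℂ g z₀ ∧ f =ᶠ[𝓝[≠] z₀] g :=
  ⟨_, hf.meromorphicOrderAt_nonneg_iff_analyticAt_toMeromorphicNFAt.1 h,
    hf.eq_nhdsNE_toMeromorphicNFAt⟩

/-- A meromorphic function of order at least that of `f` is an analytic multiple of `f`. -/
lemma _root_.MeromorphicAt.exists_analyticAt_mul {f g : ℂ → ℂ} (hf : MeromorphicAt f z₀)
    (hg : MeromorphicAt g z₀) (h : meromorphicOrderAt f z₀ ≤ meromorphicOrderAt g z₀) :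
    ∃ c : ℂ → ℂ, AnalyticAt ℂ c z₀ ∧ ∀ᶠ z in 𝓝[≠] z₀, c z * f z = g z := by
  by_cases hf' : meromorphicOrderAt f z₀ = ⊤
  · rw [hf', top_le_iff] at h
    refine ⟨0, analyticAt_const, ?_⟩
    filter_upwards [meromorphicOrderAt_eq_top_iff.1 h] with z hz
    simp [hz]
  · have hne := (meromorphicOrderAt_ne_top_iff_eventually_ne_zero hf).1 hf'
    have hord : 0 ≤ meromorphicOrderAt (g * f⁻¹) z₀ := by
      rw [meromorphicOrderAt_mul hg hf.inv, meromorphicOrderAt_inv]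
      obtain ⟨a, ha⟩ := WithTop.ne_top_iff_exists.1 hf'
      rw [← ha] at h ⊢
      by_cases hgt : meromorphicOrderAt g z₀ = ⊤
      · rw [hgt]; simp
      · obtain ⟨b, hb⟩ := WithTop.ne_top_iff_exists.1 hgt
        rw [← hb] at h ⊢
        have hab := WithTop.coe_le_coe.1 h
        change ((0 : ℤ) : WithTop ℤ) ≤ ((b + -a : ℤ) : WithTop ℤ)
        exact WithTop.coe_le_coe.2 (by omega)
    obtain ⟨c, hc, hcg⟩ := (hg.mul hf.inv).exists_analyticAt hord
    refine ⟨c, hc, ?_⟩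
    filter_upwards [hcg, hne] with z hz hfz
    rw [← hz]
    simp [hfz]

/-- A meromorphic matrix function without pole at `z₀` agrees with an analytic one near `z₀`. -/
lemma exists_isAnalyticAt_of_not_isPole (hF : ∀ i j, MeromorphicAt (fun z => F z i j) z₀)
    (h : ¬ IsPole F z₀) : ∃ A, IsAnalyticAt A z₀ ∧ F =ᶠ[𝓝[≠] z₀] A := by
  simp only [IsPole, not_exists, not_lt] at h
  choose g hg hFg using fun i j => (hF i j).exists_analyticAt (h i j)
  refine ⟨fun z => Matrix.of fun i j => g i j z, fun i j => hg i j, ?_⟩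
  filter_upwards [eventually_all.2 fun i => eventually_all.2 (hFg i)] with z hz
  ext i j
  exact hz i j

lemma IsAnalyticAt.not_isPole (hA : IsAnalyticAt A z₀) (h : F =ᶠ[𝓝[≠] z₀] A) :
    ¬ IsPole F z₀ := by
  rintro ⟨i, j, hij⟩
  have : (fun z => F z i j) =ᶠ[𝓝[≠] z₀] fun z => A z i j := by
    filter_upwards [h] with z hz
    rw [hz]
  rw [meromorphicOrderAt_congr this] at hij
  exact absurd (hA i j).meromorphicOrderAt_nonneg (not_le.2 hij)

/-- Multiplication by an analytic matrix function creates no poles. -/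
lemma IsAnalyticAt.not_isPole_mul (hA : IsAnalyticAt A z₀)
    (hF : ∀ i j, MeromorphicAt (fun z => F z i j) z₀) (h : ¬ IsPole F z₀) :
    ¬ IsPole (fun z => A z * F z) z₀ := by
  obtain ⟨B, hB, hFB⟩ := exists_isAnalyticAt_of_not_isPole hF h
  refine (hA.mul hB).not_isPole ?_
  filter_upwards [hFB] with z hz
  rw [hz]

lemma meromorphicAt_mul_entry (hA : ∀ i j, MeromorphicAt (fun z => A z i j) z₀)
    (hB : ∀ i j, MeromorphicAt (fun z => B z i j) z₀) (i j : Fin n) :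
    MeromorphicAt (fun z => (A z * B z) i j) z₀ := by
  simp only [Matrix.mul_apply]
  exact MeromorphicAt.fun_sum fun k _ => (hA i k).mul (hB k j)

lemma meromorphicAt_det (hA : ∀ i j, MeromorphicAt (fun z => A z i j) z₀) :
    MeromorphicAt (fun z => (A z).det) z₀ := by
  simp only [Matrix.det_apply']
  exact MeromorphicAt.fun_sum fun σ _ =>
    (MeromorphicAt.const _ _).mul (MeromorphicAt.fun_prod fun i _ => hA _ _)

/-! ### The functions `I + (t - 1) Q` for an idempotent matrix `Q` -/

/-- The matrix acting as `t` on the range and as `1` on the kernel of the idempotent `Q`. -/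
def pencil (Q : Matrix (Fin n) (Fin n) ℂ) (t : ℂ) : Matrix (Fin n) (Fin n) ℂ :=
  1 + (t - 1) • Q

variable {Q : Matrix (Fin n) (Fin n) ℂ}

@[simp] lemma pencil_one : pencil Q 1 = 1 := by simp [pencil]

lemma pencil_mul (hQ : Q * Q = Q) (s t : ℂ) : pencil Q s * pencil Q t = pencil Q (s * t) := by
  simp only [pencil, add_mul, mul_add, one_mul, mul_one, smul_mul_assoc, mul_smul_comm, hQ]
  module

lemma det_pencil_ne_zero (hQ : Q * Q = Q) {t : ℂ} (ht : t ≠ 0) : (pencil Q t).det ≠ 0 :=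
  Matrix.det_ne_zero_of_left_inverse (B := pencil Q t⁻¹) (by
    rw [pencil_mul hQ, inv_mul_cancel₀ ht, pencil_one])

lemma isAnalyticAt_pencil {f : ℂ → ℂ} (hf : AnalyticAt ℂ f z₀) :
    IsAnalyticAt (fun z => pencil Q (f z)) z₀ :=
  (IsAnalyticAt.const 1).add ((IsAnalyticAt.const Q).smul (hf.sub analyticAt_const))

lemma linearFactor_eq_pencil (w : ℂ) (z : ℂ) : linearFactor w Q z = pencil Q (1 - z / w) := by
  simp only [linearFactor, pencil]
  module

/-- All positive powers of an idempotent coincide, so past its constant term the exponential series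
is the scalar series times `Q`. -/
lemma exp_smul_eq_pencil (hQ : Q * Q = Q) (c : ℂ) :
    NormedSpace.exp (c • Q) = pencil Q (Complex.exp c) := by
  have hpow : ∀ k : ℕ, Q ^ (k + 1) = Q := by
    intro k
    induction k with
    | zero => simp
    | succ k ih => rw [pow_succ, ih, hQ]
  have h1 := NormedSpace.exp_series_hasSum_exp' (𝕂 := ℂ) (c • Q)
  have h2 := (NormedSpace.exp_series_hasSum_exp' (𝕂 := ℂ) c).smul_const Q
  rw [← Complex.exp_eq_exp_ℂ] at h2
  rw [← hasSum_nat_add_iff' 1] at h1 h2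
  have : (fun k : ℕ => (((k + 1).factorial : ℂ)⁻¹) • (c • Q) ^ (k + 1)) =
      fun k : ℕ => ((((k + 1).factorial : ℂ)⁻¹) • c ^ (k + 1)) • Q := by
    funext k
    rw [smul_pow, hpow, smul_assoc]
  rw [this] at h1
  have h3 := h1.unique h2
  simp only [Finset.range_one, Finset.sum_singleton, Nat.factorial_zero, Nat.cast_one, inv_one,
    pow_zero, one_smul] at h3
  rw [pencil, sub_smul, one_smul, ← h3]
  abel

end MatFact
namespace MatFact

variable {n : ℕ} {F A B C : ℂ → Matrix (Fin n) (Fin n) ℂ} {z₀ : ℂ}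

/-! ### Existence of the local form -/

/-- `F` and `B` differ near `z₀` by analytic invertible factors on both sides. -/
def LocallyEquivalent (F B : ℂ → Matrix (Fin n) (Fin n) ℂ) (z₀ : ℂ) : Prop :=
  ∃ M N : ℂ → Matrix (Fin n) (Fin n) ℂ,
    IsAnalyticAt M z₀ ∧ IsAnalyticAt N z₀ ∧ (M z₀).det ≠ 0 ∧ (N z₀).det ≠ 0 ∧
      ∀ᶠ z in 𝓝[≠] z₀, F z = M z * B z * N z

lemma LocallyEquivalent.refl (F : ℂ → Matrix (Fin n) (Fin n) ℂ) (z₀ : ℂ) :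
    LocallyEquivalent F F z₀ :=
  ⟨fun _ => 1, fun _ => 1, .const _, .const _, by simp, by simp, by simp⟩

lemma LocallyEquivalent.trans (h₁ : LocallyEquivalent A B z₀) (h₂ : LocallyEquivalent B C z₀) :
    LocallyEquivalent A C z₀ := by
  obtain ⟨M, N, hM, hN, hM0, hN0, h⟩ := h₁
  obtain ⟨M', N', hM', hN', hM0', hN0', h'⟩ := h₂
  refine ⟨fun z => M z * M' z, fun z => N' z * N z, hM.mul hM', hN'.mul hN, ?_, ?_, ?_⟩
  · rw [Matrix.det_mul]; exact mul_ne_zero hM0 hM0'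
  · rw [Matrix.det_mul]; exact mul_ne_zero hN0' hN0
  · filter_upwards [h, h'] with z hz hz'
    rw [hz, hz']; simp only [Matrix.mul_assoc]

lemma locallyEquivalent_submatrix (B : ℂ → Matrix (Fin n) (Fin n) ℂ) (z₀ : ℂ)
    (σ τ : Equiv.Perm (Fin n)) :
    LocallyEquivalent B (fun z => (B z).submatrix σ τ) z₀ := by
  refine ⟨fun _ => (1 : Matrix (Fin n) (Fin n) ℂ).submatrix id σ,
    fun _ => (1 : Matrix (Fin n) (Fin n) ℂ).submatrix τ id, .const _, .const _, ?_, ?_, ?_⟩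
  · rw [Matrix.det_permute']; simp
  · rw [Matrix.det_permute]; simp
  · refine Eventually.of_forall fun z => ?_
    rw [Matrix.submatrix_mul_equiv, Matrix.submatrix_mul_equiv]
    simp

/-- The off-diagonal entries of `B` in the rows and columns indexed by `s` vanish near `z₀`. -/
def IsDiagonalOn (B : ℂ → Matrix (Fin n) (Fin n) ℂ) (z₀ : ℂ) (s : Finset (Fin n)) : Prop :=
  ∀ i j, i ≠ j → (i ∈ s ∨ j ∈ s) → ∀ᶠ z in 𝓝[≠] z₀, B z i j = 0

/-- A row swap and a column swap bring an entry of least order in the remaining block to position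
`(p, p)`. Both swaps fix `s` pointwise, so the part already diagonalized survives. -/
lemma exists_pivot (hB : ∀ i j, MeromorphicAt (fun z => B z i j) z₀) {s : Finset (Fin n)}
    (hs : IsDiagonalOn B z₀ s) {p : Fin n} (hp : p ∉ s) :
    ∃ C, LocallyEquivalent B C z₀ ∧ (∀ i j, MeromorphicAt (fun z => C z i j) z₀) ∧
      IsDiagonalOn C z₀ s ∧ ∀ i ∉ s, ∀ j ∉ s,
        meromorphicOrderAt (fun z => C z p p) z₀ ≤ meromorphicOrderAt (fun z => C z i j) z₀ := by
  obtain ⟨⟨a, b⟩, hab, hmin⟩ := (sᶜ ×ˢ sᶜ).exists_min_image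
    (fun q : Fin n × Fin n => meromorphicOrderAt (fun z => B z q.1 q.2) z₀)
    ⟨(p, p), by simp [hp]⟩
  simp only [Finset.mem_product, Finset.mem_compl, Prod.forall] at hab hmin
  have hmem : ∀ c ∉ s, ∀ i, (Equiv.swap p c i ∈ s ↔ i ∈ s) := by
    intro c hc i
    by_cases h1 : i = p
    · subst h1; simp [hp, hc]
    by_cases h2 : i = c
    · subst h2; simp [hp, hc]
    rw [Equiv.swap_apply_of_ne_of_ne h1 h2]
  have hfix : ∀ c ∉ s, ∀ i ∈ s, Equiv.swap p c i = i := by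
    intro c hc i hi
    exact Equiv.swap_apply_of_ne_of_ne (by rintro rfl; exact hp hi) (by rintro rfl; exact hc hi)
  refine ⟨_, locallyEquivalent_submatrix B z₀ (Equiv.swap p a) (Equiv.swap p b),
    fun i j => hB _ _, ?_, ?_⟩
  · intro i j hij h
    refine hs _ _ ?_ ?_
    · rcases h with h | h
      · rw [hfix a hab.1 i h]
        intro h'
        have : j ∈ s := by rw [← hmem b hab.2, ← h']; exact h
        rw [hfix b hab.2 j this] at h'
        exact hij h'
      · rw [hfix b hab.2 j h]
        intro h'
        have : i ∈ s := by rw [← hmem a hab.1, h']; exact h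
        rw [hfix a hab.1 i this] at h'
        exact hij h'
    · rwa [hmem a hab.1, hmem b hab.2]
  · intro i hi j hj
    simp only [Matrix.submatrix_apply, Equiv.swap_apply_left]
    exact hmin _ _ ⟨by rwa [hmem a hab.1], by rwa [hmem b hab.2]⟩

/-- The rank-one matrix squares to `c p` times itself, hence to zero. Elementary row operations are
therefore analytically invertible. -/
lemma one_add_vecMulVec_single_mul {p : Fin n} {c : Fin n → ℂ} (hc : c p = 0) :
    (1 + Matrix.vecMulVec c (Pi.single p 1)) * (1 - Matrix.vecMulVec c (Pi.single p 1)) = 1 := by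
  have : Matrix.vecMulVec c (Pi.single p 1) * Matrix.vecMulVec c (Pi.single p 1) = 0 := by
    rw [Matrix.vecMulVec_mul_vecMulVec]
    simp [hc]
  rw [mul_sub, mul_one, add_mul, one_mul, this]
  simp

lemma one_sub_single_vecMulVec_mul {p : Fin n} {c : Fin n → ℂ} (hc : c p = 0) :
    (1 - Matrix.vecMulVec (Pi.single p 1) c) * (1 + Matrix.vecMulVec (Pi.single p 1) c) = 1 := by
  have : Matrix.vecMulVec (Pi.single p 1) c * Matrix.vecMulVec (Pi.single p 1) c = 0 := by
    rw [Matrix.vecMulVec_mul_vecMulVec]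
    simp [hc]
  rw [mul_add, mul_one, sub_mul, one_mul, this]
  simp

lemma isAnalyticAt_vecMulVec {b c : Fin n → ℂ → ℂ} (hb : ∀ i, AnalyticAt ℂ (b i) z₀)
    (hc : ∀ i, AnalyticAt ℂ (c i) z₀) :
    IsAnalyticAt (fun z => Matrix.vecMulVec (fun i => b i z) (fun i => c i z)) z₀ :=
  fun i j => (hb i).mul (hc j)

/-- One elimination step: minimality of the pivot's order makes the quotients by the pivot analytic,
so row and column `p` can be cleared by invertible analytic operations. -/
lemma exists_isDiagonalOn_insert (hB : ∀ i j, MeromorphicAt (fun z => B z i j) z₀)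
    {s : Finset (Fin n)} (hs : IsDiagonalOn B z₀ s) {p : Fin n} (hp : p ∉ s)
    (hmin : ∀ i ∉ s, ∀ j ∉ s,
      meromorphicOrderAt (fun z => B z p p) z₀ ≤ meromorphicOrderAt (fun z => B z i j) z₀) :
    ∃ C, LocallyEquivalent B C z₀ ∧ (∀ i j, MeromorphicAt (fun z => C z i j) z₀) ∧
      IsDiagonalOn C z₀ (insert p s) := by
  -- The multipliers vanish at `p` and on `s`, so the pivot row and the diagonal part are left
  -- alone.
  have hcol : ∀ i, ∃ c : ℂ → ℂ, AnalyticAt ℂ c z₀ ∧ ((i = p ∨ i ∈ s) → c = 0) ∧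
      (i ≠ p → ∀ᶠ z in 𝓝[≠] z₀, c z * B z p p = B z i p) := by
    intro i
    by_cases h : i = p ∨ i ∈ s
    · refine ⟨0, analyticAt_const, fun _ => rfl, fun hip => ?_⟩
      filter_upwards [hs i p hip (Or.inl (h.resolve_left hip))] with z hz
      simp [hz]
    · have h' := not_or.1 h
      obtain ⟨c, hc, hc'⟩ := (hB p p).exists_analyticAt_mul (hB i p) (hmin i h'.2 p hp)
      exact ⟨c, hc, fun h'' => absurd h'' h, fun _ => hc'⟩
  have hrow : ∀ j, ∃ c : ℂ → ℂ, AnalyticAt ℂ c z₀ ∧ ((j = p ∨ j ∈ s) → c = 0) ∧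
      (j ≠ p → ∀ᶠ z in 𝓝[≠] z₀, c z * B z p p = B z p j) := by
    intro j
    by_cases h : j = p ∨ j ∈ s
    · refine ⟨0, analyticAt_const, fun _ => rfl, fun hjp => ?_⟩
      filter_upwards [hs p j (Ne.symm hjp) (Or.inr (h.resolve_left hjp))] with z hz
      simp [hz]
    · have h' := not_or.1 h
      obtain ⟨c, hc, hc'⟩ := (hB p p).exists_analyticAt_mul (hB p j) (hmin p hp j h'.2)
      exact ⟨c, hc, fun h'' => absurd h'' h, fun _ => hc'⟩
  choose c hc hc0 hcB using hcol
  choose b hb hb0 hbB using hrow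
  have he : ∀ i, AnalyticAt ℂ (fun _ : ℂ => (Pi.single p 1 : Fin n → ℂ) i) z₀ :=
    fun i => analyticAt_const
  have hcp : c p = 0 := hc0 p (Or.inl rfl)
  have hbp : b p = 0 := hb0 p (Or.inl rfl)
  set X : ℂ → Matrix (Fin n) (Fin n) ℂ :=
    fun z => Matrix.vecMulVec (fun i => c i z) (Pi.single p 1) with hX
  set Y : ℂ → Matrix (Fin n) (Fin n) ℂ :=
    fun z => Matrix.vecMulVec (Pi.single p 1) (fun i => b i z) with hY
  have hXa : IsAnalyticAt X z₀ := isAnalyticAt_vecMulVec hc he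
  have hYa : IsAnalyticAt Y z₀ := isAnalyticAt_vecMulVec he hb
  have hXX : ∀ z, (1 + X z) * (1 - X z) = 1 := fun z =>
    one_add_vecMulVec_single_mul (by simp [hcp])
  have hYY : ∀ z, (1 - Y z) * (1 + Y z) = 1 := fun z =>
    one_sub_single_vecMulVec_mul (by simp [hbp])
  have hentry : ∀ z i j, ((1 - X z) * B z * (1 - Y z)) i j =
      B z i j - c i z * B z p j - (B z i p - c i z * B z p p) * b j z := by
    intro z i j
    have h1 : ∀ k, ((1 - X z) * B z) i k = B z i k - c i z * B z p k := by
      intro k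
      rw [sub_mul, one_mul, Matrix.sub_apply, hX]
      simp [Matrix.mul_apply, Matrix.vecMulVec_apply, Pi.single_apply]
    rw [mul_sub, mul_one, Matrix.sub_apply, h1, Matrix.mul_apply]
    simp [h1, hY, Matrix.vecMulVec_apply, Pi.single_apply]
  refine ⟨fun z => (1 - X z) * B z * (1 - Y z), ⟨fun z => 1 + X z, fun z => 1 + Y z,
    (IsAnalyticAt.const 1).add hXa, (IsAnalyticAt.const 1).add hYa, ?_, ?_, ?_⟩, ?_, ?_⟩
  · exact Matrix.det_ne_zero_of_right_inverse (hXX z₀)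
  · exact Matrix.det_ne_zero_of_left_inverse (hYY z₀)
  · refine Eventually.of_forall fun z => ?_
    calc B z = ((1 + X z) * (1 - X z)) * B z * ((1 - Y z) * (1 + Y z)) := by
          rw [hXX, hYY, one_mul, mul_one]
      _ = _ := by simp only [Matrix.mul_assoc]
  · intro i j
    simp only [hentry]
    exact (((hB i j).sub ((hc i).meromorphicAt.mul (hB p j))).sub
      (((hB i p).sub ((hc i).meromorphicAt.mul (hB p p))).mul (hb j).meromorphicAt))
  · intro i j hij h
    simp only [hentry, Finset.mem_insert] at h ⊢
    by_cases hi : i = p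
    · subst hi
      filter_upwards [hbB j hij.symm] with z hz
      rw [hcp, ← hz]; simp; ring
    by_cases hj : j = p
    · subst hj
      filter_upwards [hcB i hi] with z hz
      rw [hbp, ← hz]; simp
    simp only [hi, hj, false_or] at h
    filter_upwards [hs i j hij h, hcB i hi, hbB j hj] with z hz hz1 hz2
    rcases h with h | h
    · rw [hz, ← hz1, hc0 i (Or.inr h)]; simp
    · rw [hz, ← hz2, hb0 j (Or.inr h)]; simp

lemma exists_isDiagonalOn (hF : ∀ i j, MeromorphicAt (fun z => F z i j) z₀)
    (s : Finset (Fin n)) :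
    ∃ B, LocallyEquivalent F B z₀ ∧ (∀ i j, MeromorphicAt (fun z => B z i j) z₀) ∧
      IsDiagonalOn B z₀ s := by
  induction s using Finset.induction_on with
  | empty => exact ⟨F, .refl _ _, hF, fun i j _ h => by simp at h⟩
  | insert p s hp ih =>
    obtain ⟨B, hFB, hB, hs⟩ := ih
    obtain ⟨C, hBC, hC, hsC, hmin⟩ := exists_pivot hB hs hp
    obtain ⟨D, hCD, hD, hsD⟩ := exists_isDiagonalOn_insert hC hsC hp hmin
    exact ⟨D, (hFB.trans hBC).trans hCD, hD, hsD⟩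

/-- Every meromorphic matrix function with determinant not identically zero has a local form. -/
theorem exists_hasLocalForm (hF : ∀ i j, MeromorphicAt (fun z => F z i j) z₀)
    (hdet : meromorphicOrderAt (fun z => (F z).det) z₀ ≠ ⊤) : ∃ r, HasLocalForm F z₀ r := by
  obtain ⟨B, hFB, hB, hs⟩ := exists_isDiagonalOn hF Finset.univ
  have hdiag : ∀ᶠ z in 𝓝[≠] z₀, B z = Matrix.diagonal (fun j => B z j j) := by
    have : ∀ i j, ∀ᶠ z in 𝓝[≠] z₀, B z i j = Matrix.diagonal (fun j => B z j j) i j := by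
      intro i j
      by_cases hij : i = j
      · subst hij; simp
      · filter_upwards [hs i j hij (by simp)] with z hz
        rw [hz, Matrix.diagonal_apply_ne _ hij]
    filter_upwards [eventually_all.2 fun i => eventually_all.2 (this i)] with z hz
    ext i j
    exact hz i j
  -- A diagonal entry vanishing identically near `z₀` would make det F vanish there.
  have hne : ∀ j, meromorphicOrderAt (fun z => B z j j) z₀ ≠ ⊤ := by
    intro j hj
    obtain ⟨M, N, hM, hN, hM0, hN0, h⟩ := hFB
    refine hdet (meromorphicOrderAt_eq_top_iff.2 ?_)
    filter_upwards [h, hdiag, meromorphicOrderAt_eq_top_iff.1 hj] with z h1 h2 h3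
    rw [h1, h2, Matrix.det_mul, Matrix.det_mul, Matrix.det_diagonal,
      Finset.prod_eq_zero (f := fun i => B z i i) (Finset.mem_univ j) h3]
    simp
  choose g hg hg0 hgB using fun j => (meromorphicOrderAt_ne_top_iff (hB j j)).1 (hne j)
  set d : Fin n → ℤ := fun j => (meromorphicOrderAt (fun z => B z j j) z₀).untop₀ with hd
  have hBD : LocallyEquivalent B (fun z => Matrix.diagonal fun j => (z - z₀) ^ d j) z₀ := by
    refine ⟨fun z => Matrix.diagonal fun j => g j z, fun _ => 1, ?_, .const _, ?_, by simp, ?_⟩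
    · intro i j
      by_cases hij : i = j
      · subst hij; simpa using hg i
      · simp only [Matrix.diagonal_apply_ne _ hij]; exact analyticAt_const
    · rw [Matrix.det_diagonal]
      exact Finset.prod_ne_zero_iff.2 fun j _ => hg0 j
    · filter_upwards [hdiag, eventually_all.2 hgB] with z h1 h2
      rw [h1, mul_one, Matrix.diagonal_mul_diagonal]
      congr 1
      funext j
      rw [h2 j, smul_eq_mul, mul_comm]
  have hsort := locallyEquivalent_submatrix (fun z => Matrix.diagonal fun j => (z - z₀) ^ d j) z₀
    (Tuple.sort d) (Tuple.sort d)
  refine ⟨d ∘ Tuple.sort d, Tuple.monotone_sort d, ?_⟩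
  simp only [Matrix.submatrix_diagonal_equiv] at hsort
  exact (hFB.trans hBD).trans hsort

end MatFact
namespace MatFact

variable {n : ℕ} {F A B C : ℂ → Matrix (Fin n) (Fin n) ℂ} {z₀ : ℂ} {r r' : Fin n → ℤ}

/-! ### Uniqueness of the local form -/

lemma HasLocalForm.mul_left (h : HasLocalForm F z₀ r) (hA : IsAnalyticAt A z₀)
    (hA0 : (A z₀).det ≠ 0) : HasLocalForm (fun z => A z * F z) z₀ r := by
  obtain ⟨hr, M, N, hM, hN, hM0, hN0, hF⟩ := h
  refine ⟨hr, fun z => A z * M z, N, hA.mul hM, hN, ?_, hN0, ?_⟩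
  · rw [Matrix.det_mul]; exact mul_ne_zero hA0 hM0
  · filter_upwards [hF] with z hz
    rw [hz]; simp only [Matrix.mul_assoc]

/-- Pigeonhole: `σ` cannot map all indices up to `j` into those below `j`. So some `i ≤ j` has `j ≤
σ i`, and then g j ≤ g (σ i) ≤ f i ≤ f j. -/
lemma le_of_monotone_of_perm {f g : Fin n → ℤ} (hf : Monotone f) (hg : Monotone g)
    (σ : Equiv.Perm (Fin n)) (h : ∀ j, g (σ j) ≤ f j) : g ≤ f := by
  intro j
  obtain ⟨i, hij, hi⟩ : ∃ i ≤ j, j ≤ σ i := by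
    by_contra! hcon
    have hmaps : (Finset.Iic j).image σ ⊆ Finset.Iio j := by
      intro k hk
      obtain ⟨i, hi, rfl⟩ := Finset.mem_image.1 hk
      exact Finset.mem_Iio.2 (hcon i (Finset.mem_Iic.1 hi))
    have := Finset.card_le_card hmaps
    rw [Finset.card_image_of_injective _ σ.injective, Fin.card_Iic, Fin.card_Iio] at this
    omega
  exact ((hg hi).trans (h i)).trans (hf hij)

/-- If k > l, dividing by (z - z₀)^l leaves a left side tending to 0 and a right side tending to
a(z₀) ≠ 0. -/
lemma zpow_exponent_le {a b : ℂ → ℂ} (ha : AnalyticAt ℂ a z₀) (ha0 : a z₀ ≠ 0)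
    (hb : AnalyticAt ℂ b z₀) {k l : ℤ}
    (h : ∀ᶠ z in 𝓝[≠] z₀, (z - z₀) ^ k * b z = a z * (z - z₀) ^ l) : k ≤ l := by
  by_contra! hlt
  have h1 : Tendsto a (𝓝[≠] z₀) (𝓝 (a z₀)) := ha.continuousAt.continuousWithinAt
  have h2 : Tendsto (fun z => (z - z₀) ^ (k - l).toNat * b z) (𝓝[≠] z₀)
      (𝓝 ((z₀ - z₀) ^ (k - l).toNat * b z₀)) :=
    ContinuousAt.continuousWithinAt (by have := hb.continuousAt; fun_prop)
  rw [sub_self, zero_pow (by omega), zero_mul] at h2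
  refine ha0 (tendsto_nhds_unique h1 (h2.congr' ?_))
  filter_upwards [h, self_mem_nhdsWithin] with z hz hne
  have hne' : z - z₀ ≠ 0 := sub_ne_zero.2 hne
  have : (z - z₀) ^ k = (z - z₀) ^ (k - l).toNat * (z - z₀) ^ l := by
    rw [← zpow_natCast, ← zpow_add₀ hne']; congr 1; omega
  rw [this, mul_right_comm] at hz
  exact mul_right_cancel₀ (zpow_ne_zero l hne') hz

/-- Comparing two local forms gives D' (N' N⁻¹) = (M'⁻¹ M) D. Since M'⁻¹M is invertible at `z₀`, a
nonzero term of the Leibniz formula yields a permutation along which its entries do not vanish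
there; comparing orders entrywise gives r' (σ j) ≤ r j. -/
lemma HasLocalForm.le (h : HasLocalForm F z₀ r) (h' : HasLocalForm F z₀ r') : r' ≤ r := by
  obtain ⟨hr, M, N, hM, hN, hM0, hN0, hF⟩ := h
  obtain ⟨hr', M', N', hM', hN', hM0', hN0', hF'⟩ := h'
  have hA : IsAnalyticAt (fun z => (M' z)⁻¹ * M z) z₀ := (hM'.inv hM0').mul hM
  have hB : IsAnalyticAt (fun z => N' z * (N z)⁻¹) z₀ := hN'.mul (hN.inv hN0)
  have hA0 : ((M' z₀)⁻¹ * M z₀).det ≠ 0 := by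
    rw [Matrix.det_mul, Matrix.det_nonsing_inv, Ring.inverse_eq_inv']
    exact mul_ne_zero (inv_ne_zero hM0') hM0
  have key : ∀ᶠ z in 𝓝[≠] z₀, ∀ i j,
      (z - z₀) ^ r' i * (N' z * (N z)⁻¹) i j = ((M' z)⁻¹ * M z) i j * (z - z₀) ^ r j := by
    filter_upwards [hF, hF', (hM'.eventually_det_ne_zero hM0').filter_mono nhdsWithin_le_nhds,
      (hN.eventually_det_ne_zero hN0).filter_mono nhdsWithin_le_nhds] with z h1 h2 h3 h4 i j
    have e : M z * Matrix.diagonal (fun j => (z - z₀) ^ r j) * N z =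
      M' z * Matrix.diagonal (fun j => (z - z₀) ^ r' j) * N' z := h1.symm.trans h2
    have e1 := congrArg (fun X => (M' z)⁻¹ * X * (N z)⁻¹) e
    simp only [Matrix.mul_assoc] at e1
    rw [Matrix.mul_nonsing_inv _ (Ne.isUnit h4), Matrix.mul_one,
      Matrix.nonsing_inv_mul_cancel_left _ _ (Ne.isUnit h3)] at e1
    exact (Matrix.diagonal_mul _ _ i j).symm.trans
      ((congrFun (congrFun e1 i) j).symm.trans
        ((congrFun (congrFun (Matrix.mul_assoc _ _ _) i) j).symm.trans
          (Matrix.mul_diagonal _ _ i j)))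
  obtain ⟨σ, hσ⟩ : ∃ σ : Equiv.Perm (Fin n), ∀ j, ((M' z₀)⁻¹ * M z₀) (σ j) j ≠ 0 := by
    rw [Matrix.det_apply'] at hA0
    obtain ⟨σ, -, hσ⟩ := Finset.exists_ne_zero_of_sum_ne_zero hA0
    exact ⟨σ, fun j => Finset.prod_ne_zero_iff.1 (right_ne_zero_of_mul hσ) j (Finset.mem_univ j)⟩
  exact le_of_monotone_of_perm hr hr' σ fun j =>
    zpow_exponent_le (hA (σ j) j) (hσ j) (hB (σ j) j) (key.mono fun z hz => hz _ _)

theorem HasLocalForm.unique (h : HasLocalForm F z₀ r) (h' : HasLocalForm F z₀ r') : r = r' :=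
  le_antisymm (h'.le h) (h.le h')

/-- The partial pole multiplicities read off from the exponents of a local form. -/
def negativeParts (r : Fin n → ℤ) : Multiset ℕ :=
  (Finset.univ.filter (fun j => r j < 0)).val.map (fun j => (r j).natAbs)

lemma HasLocalForm.hasPartialPoleMultiplicities_iff (h : HasLocalForm F z₀ r) {m : Multiset ℕ} :
    HasPartialPoleMultiplicities F z₀ m ↔ m = negativeParts r := by
  constructor
  · rintro ⟨r', hr', rfl⟩
    rw [h.unique hr', negativeParts]
  · rintro rfl
    exact ⟨r, h, rfl⟩

/-- Raise the negative exponents by one. -/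
def raiseNegative (r : Fin n → ℤ) (j : Fin n) : ℤ := if r j < 0 then r j + 1 else r j

lemma monotone_raiseNegative (hr : Monotone r) : Monotone (raiseNegative r) := by
  intro i j hij
  have := hr hij
  simp only [raiseNegative]
  split_ifs <;> omega

/-- Exponents equal to -1 become 0 and leave the list; this is the dropping of zeros. -/
lemma negativeParts_raiseNegative (r : Fin n → ℤ) :
    negativeParts (raiseNegative r) = lowerByOne (negativeParts r) := by
  have hfilter : (Finset.univ.filter fun j => raiseNegative r j < 0) =
      (Finset.univ.filter fun j => r j < 0).filter fun j => (r j).natAbs - 1 ≠ 0 := by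
    ext j
    simp only [Finset.mem_filter, Finset.mem_univ, true_and]
    simp only [raiseNegative]
    split_ifs <;> omega
  rw [negativeParts, lowerByOne, negativeParts, Multiset.map_map, Multiset.filter_map, hfilter,
    Finset.filter_val]
  refine Multiset.map_congr rfl fun j hj => ?_
  have := (Multiset.mem_filter.1 hj).1
  simp only [Finset.mem_val, Finset.mem_filter, Finset.mem_univ, true_and] at this
  simp only [raiseNegative, if_pos this, Function.comp_apply]
  omega

lemma poleMultiplicitiesLowered_of_hasLocalForm (h : HasLocalForm F z₀ r)
    (h' : HasLocalForm A z₀ (raiseNegative r)) : PoleMultiplicitiesLowered F A z₀ := by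
  refine ⟨⟨_, h.hasPartialPoleMultiplicities_iff.2 rfl⟩, fun m hm m' => ?_⟩
  rw [h'.hasPartialPoleMultiplicities_iff, h.hasPartialPoleMultiplicities_iff.1 hm,
    negativeParts_raiseNegative]

lemma HasLocalForm.not_isPole (h : HasLocalForm F z₀ r) (hr : ∀ j, 0 ≤ r j) : ¬ IsPole F z₀ := by
  obtain ⟨-, M, N, hM, hN, -, -, hF⟩ := h
  refine IsAnalyticAt.not_isPole
    (A := fun z => M z * Matrix.diagonal (fun j => (z - z₀) ^ (r j).toNat) * N z)
    ((hM.mul fun i j => ?_).mul hN) ?_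
  · by_cases hij : i = j
    · subst hij; simp only [Matrix.diagonal_apply_eq]
      exact (analyticAt_id.sub analyticAt_const).pow _
    · simp only [Matrix.diagonal_apply_ne _ hij]; exact analyticAt_const
  · filter_upwards [hF] with z hz
    rw [hz]
    congr 3
    funext j
    rw [← zpow_natCast, Int.toNat_of_nonneg (hr j)]

/-! ### The pole space -/

/-- The projection onto the coordinates with negative exponent. -/
def negativeCoords (r : Fin n → ℤ) : Matrix (Fin n) (Fin n) ℂ :=
  Matrix.diagonal fun j => if r j < 0 then 1 else 0

lemma negativeCoords_mul_self (r : Fin n → ℤ) :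
    negativeCoords r * negativeCoords r = negativeCoords r := by
  simp [negativeCoords, Matrix.diagonal_mul_diagonal]

lemma IsOrthogonalProjectionOnto.mulVec_eq {Q : Matrix (Fin n) (Fin n) ℂ}
    {S : Submodule ℂ (Fin n → ℂ)} (hQ : IsOrthogonalProjectionOnto Q S) {v : Fin n → ℂ}
    (hv : v ∈ S) : Q.mulVec v = v := by
  rw [← hQ.2] at hv
  obtain ⟨u, rfl⟩ := hv
  rw [Matrix.mulVecLin_apply, Matrix.mulVec_mulVec, hQ.1.isIdempotentElem.eq]

section PoleSpace

variable {M N : ℂ → Matrix (Fin n) (Fin n) ℂ}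
  (hM : IsAnalyticAt M z₀) (hN : IsAnalyticAt N z₀) (hM0 : (M z₀).det ≠ 0) (hN0 : (N z₀).det ≠ 0)
  (hF : ∀ᶠ z in 𝓝[≠] z₀, F z = M z * Matrix.diagonal (fun j => (z - z₀) ^ r j) * N z)

include hM hN hM0 hN0 hF

/-- Take V = M e_j: then F⁻¹V = (z - z₀)^(-r_j) N⁻¹ e_j, which vanishes at `z₀`. -/
lemma isPoleVector_mulVec_single {j : Fin n} (hj : r j < 0) :
    IsPoleVector F z₀ ((M z₀).mulVec (Pi.single j 1)) := by
  refine ⟨fun h => ?_, fun z => (M z).mulVec (Pi.single j 1),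
    fun z => (z - z₀) ^ (-r j).toNat • (N z)⁻¹.mulVec (Pi.single j 1),
    hM.mulVec analyticAt_const, rfl, ?_, ?_, ?_⟩
  · have := Matrix.eq_zero_of_mulVec_eq_zero hM0 h
    simpa using congrFun this j
  · exact AnalyticAt.smul ((analyticAt_id.sub analyticAt_const).pow _) ((hN.inv hN0).mulVec analyticAt_const)
  · simp only [sub_self]
    rw [zero_pow (by omega), zero_smul]
  · filter_upwards [hF, (hM.eventually_det_ne_zero hM0).filter_mono nhdsWithin_le_nhds,
      (hN.eventually_det_ne_zero hN0).filter_mono nhdsWithin_le_nhds, self_mem_nhdsWithin]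
      with z h1 h2 h3 hne
    have hne' : z - z₀ ≠ 0 := sub_ne_zero.2 hne
    have hD : IsUnit (Matrix.diagonal fun j => (z - z₀) ^ r j).det := by
      rw [Matrix.det_diagonal]
      exact (Finset.prod_ne_zero_iff.2 fun i _ => zpow_ne_zero _ hne').isUnit
    have hFdet : IsUnit (F z).det := by
      rw [h1, Matrix.det_mul, Matrix.det_mul]
      exact ((Ne.isUnit h2).mul hD).mul (Ne.isUnit h3)
    have : (F z).mulVec ((z - z₀) ^ (-r j).toNat • (N z)⁻¹.mulVec (Pi.single j 1)) =
        (M z).mulVec (Pi.single j 1) := by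
      rw [h1, Matrix.mulVec_smul, Matrix.mulVec_mulVec, Matrix.mul_assoc,
        Matrix.mul_nonsing_inv _ (Ne.isUnit h3), Matrix.mul_one, ← Matrix.mulVec_mulVec,
        ← Matrix.mulVec_smul]
      congr 1
      funext i
      by_cases hij : i = j
      · subst hij
        rw [Pi.smul_apply, Matrix.mulVec_diagonal, ← zpow_natCast, Int.toNat_of_nonneg (by omega)]
        simp [inv_mul_cancel₀ (zpow_ne_zero _ hne')]
      · simp [hij]
    rw [← this, Matrix.mulVec_mulVec, Matrix.nonsing_inv_mul _ hFdet, Matrix.one_mulVec]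

/-- With H = F⁻¹V, the `j`-th coordinate of M⁻¹V is (z - z₀)^(r_j) (N H)_j, which tends to 0 because
H does. -/
lemma IsPoleVector.inv_mulVec_apply_eq_zero {v : Fin n → ℂ} (hv : IsPoleVector F z₀ v)
    {j : Fin n} (hj : 0 ≤ r j) : ((M z₀)⁻¹.mulVec v) j = 0 := by
  obtain ⟨-, V, H, hV, rfl, hH, hH0, hVH⟩ := hv
  have h1 := (analyticAt_pi_iff.1 ((hM.inv hM0).mulVec hV) j).continuousAt
  have h2 : ContinuousAt (fun z => (z - z₀) ^ (r j).toNat * ((N z).mulVec (H z)) j) z₀ := by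
    have := (analyticAt_pi_iff.1 (hN.mulVec hH) j).continuousAt
    fun_prop
  refine tendsto_nhds_unique (h1.continuousWithinAt (s := {z₀}ᶜ)).tendsto ?_
  have h3 := (h2.continuousWithinAt (s := {z₀}ᶜ)).tendsto
  rw [hH0, Matrix.mulVec_zero, Pi.zero_apply, mul_zero] at h3
  refine h3.congr' ?_
  filter_upwards [hF, (hM.eventually_det_ne_zero hM0).filter_mono nhdsWithin_le_nhds,
    (hN.eventually_det_ne_zero hN0).filter_mono nhdsWithin_le_nhds, self_mem_nhdsWithin, hVH]
    with z h1 h2 h3 hne h4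
  have hne' : z - z₀ ≠ 0 := sub_ne_zero.2 hne
  have hD : IsUnit (Matrix.diagonal fun j => (z - z₀) ^ r j).det := by
    rw [Matrix.det_diagonal]
    exact (Finset.prod_ne_zero_iff.2 fun i _ => zpow_ne_zero _ hne').isUnit
  have hFdet : IsUnit (F z).det := by
    rw [h1, Matrix.det_mul, Matrix.det_mul]
    exact ((Ne.isUnit h2).mul hD).mul (Ne.isUnit h3)
  have hFH : (F z).mulVec (H z) = V z := by
    rw [← h4, Matrix.mulVec_mulVec, Matrix.mul_nonsing_inv _ hFdet, Matrix.one_mulVec]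
  rw [← hFH, h1, Matrix.mulVec_mulVec, Matrix.mul_assoc,
    Matrix.nonsing_inv_mul_cancel_left _ _ (Ne.isUnit h2), ← Matrix.mulVec_mulVec,
    Matrix.mulVec_diagonal, ← zpow_natCast, Int.toNat_of_nonneg hj]

/-- Together with `negativeCoords_mul_of_poleSpace`, this says that Q and the oblique projection
M(z₀) J M(z₀)⁻¹ have the same range. -/
lemma mul_negativeCoords_of_poleSpace {Q : Matrix (Fin n) (Fin n) ℂ}
    (hQ : IsOrthogonalProjectionOnto Q (poleSpace F z₀)) :
    Q * (M z₀ * negativeCoords r) = M z₀ * negativeCoords r := by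
  refine Matrix.ext_of_mulVec_single fun j => ?_
  rw [← Matrix.mulVec_mulVec, ← Matrix.mulVec_mulVec]
  by_cases hj : r j < 0
  · have : (negativeCoords r).mulVec (Pi.single j 1) = Pi.single j 1 := by
      simp [negativeCoords, hj]
    rw [this]
    exact hQ.mulVec_eq (Submodule.subset_span (isPoleVector_mulVec_single hM hN hM0 hN0 hF hj))
  · have : (negativeCoords r).mulVec (Pi.single j 1) = 0 := by
      simp [negativeCoords, hj]
    rw [this]; simp

lemma negativeCoords_mul_of_poleSpace {Q : Matrix (Fin n) (Fin n) ℂ}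
    (hQ : IsOrthogonalProjectionOnto Q (poleSpace F z₀)) :
    M z₀ * negativeCoords r * (M z₀)⁻¹ * Q = Q := by
  have hle : poleSpace F z₀ ≤ LinearMap.ker
      (M z₀ * negativeCoords r * (M z₀)⁻¹ - 1).mulVecLin := by
    refine Submodule.span_le.2 fun v hv => ?_
    have hcoord : (negativeCoords r).mulVec ((M z₀)⁻¹.mulVec v) = (M z₀)⁻¹.mulVec v := by
      funext j
      rw [negativeCoords, Matrix.mulVec_diagonal]
      by_cases hj : r j < 0
      · simp [hj]
      · rw [hv.inv_mulVec_apply_eq_zero hM hN hM0 hN0 hF (not_lt.1 hj), mul_zero]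
    simp only [SetLike.mem_coe, LinearMap.mem_ker, Matrix.mulVecLin_apply, Matrix.sub_mulVec,
      Matrix.one_mulVec]
    rw [← Matrix.mulVec_mulVec, ← Matrix.mulVec_mulVec, hcoord, Matrix.mulVec_mulVec,
      Matrix.mul_nonsing_inv _ (Ne.isUnit hM0), Matrix.one_mulVec, sub_self]
  refine Matrix.ext_of_mulVec_single fun j => ?_
  have hmem : Q.mulVec (Pi.single j 1) ∈ poleSpace F z₀ := by
    rw [← hQ.2]; exact ⟨_, rfl⟩
  have := hle hmem
  rw [LinearMap.mem_ker, Matrix.mulVecLin_apply, Matrix.sub_mulVec, Matrix.one_mulVec,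
    sub_eq_zero] at this
  rw [← Matrix.mulVec_mulVec, this]

end PoleSpace

end MatFact
namespace MatFact

variable {n : ℕ} {F A : ℂ → Matrix (Fin n) (Fin n) ℂ} {z₀ : ℂ} {r : Fin n → ℤ}
  {Q : Matrix (Fin n) (Fin n) ℂ}

/-! ### The effect of a linear factor -/

lemma IsAnalyticAt.exists_eq_add_smul (hA : IsAnalyticAt A z₀) (hz₀ : z₀ ≠ 0) :
    ∃ B, IsAnalyticAt B z₀ ∧ ∀ z, A z = A z₀ + (1 - z / z₀) • B z := by
  choose g hg hgA using fun i j => (hA i j).exists_eq_add_sub_mul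
  -- The factor comes from z - z₀ = -z₀ (1 - z/z₀).
  refine ⟨fun z => Matrix.of fun i j => -z₀ * g i j z,
    fun i j => analyticAt_const.mul (hg i j), fun z => ?_⟩
  ext i j
  rw [hgA i j z]
  simp only [Matrix.add_apply, Matrix.smul_apply, Matrix.of_apply, smul_eq_mul]
  field_simp
  ring

/-- Intertwining moves I + sJ to the left of X as I + sQ', and (I + s(Q - Q'))(I + sQ') = I + sQ
because (Q - Q')Q' = 0. -/
lemma one_add_smul_sub_mul_mul {s : ℂ} {Q Q' J X : Matrix (Fin n) (Fin n) ℂ} (hX : Q' * X = X * J)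
    (hQ : Q * Q' = Q') (hQ' : Q' * Q' = Q') :
    (1 + s • (Q - Q')) * X * (1 + s • J) = (1 + s • Q) * X := by
  have h1 : X * (1 + s • J) = (1 + s • Q') * X := by
    simp only [mul_add, add_mul, mul_one, one_mul, mul_smul_comm, smul_mul_assoc, hX]
  rw [mul_assoc, h1, ← mul_assoc]
  congr 1
  simp only [mul_add, add_mul, sub_mul, mul_one, one_mul, mul_smul_comm, smul_mul_assoc, hQ, hQ']
  simp only [sub_self, smul_zero, add_zero]
  module

/-- A substitute for t times the inverse of the pencil that remains meaningful at t = 0. -/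
lemma smul_one_sub_add_mul {t : ℂ} {J : Matrix (Fin n) (Fin n) ℂ} (hJ : J * J = J) :
    (t • (1 - J) + J) * pencil J t = t • (1 : Matrix (Fin n) (Fin n) ℂ) := by
  simp only [pencil, mul_add, add_mul, sub_mul, mul_one, one_mul, mul_smul_comm, smul_mul_assoc,
    hJ]
  module

/-- Q - Q' squares to zero, and multiplying by I + (Q - Q') turns the matrix into I + (I - Q')Y.
There (I - Q')Y also squares to zero, since Y(I - Q') = 0. -/
lemma det_sub_add_mul_ne_zero {Q Q' Y : Matrix (Fin n) (Fin n) ℂ} (hQ : Q * Q = Q)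
    (h : Q * Q' = Q') (h' : Q' * Q = Q) (hQ' : Q' * Q' = Q') (hY : Y * Q' = Y) :
    (1 - (Q - Q') + (1 - Q) * Y).det ≠ 0 := by
  have hYY : (1 - Q') * Y * ((1 - Q') * Y) = 0 := by
    rw [mul_assoc, ← mul_assoc Y, mul_sub, mul_one, hY, sub_self, zero_mul, mul_zero]
  have h1 : (1 + (Q - Q')) * (1 - (Q - Q') + (1 - Q) * Y) = 1 + (1 - Q') * Y := by
    simp only [mul_add, add_mul, sub_mul, mul_sub, mul_one, one_mul, hQ, h, h', hQ', ← mul_assoc]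
    abel
  refine Matrix.det_ne_zero_of_left_inverse (B := (1 - (1 - Q') * Y) * (1 + (Q - Q'))) ?_
  rw [mul_assoc, h1, mul_add, mul_one, sub_mul 1 _ ((1 - Q') * Y), one_mul, hYY]
  abel

/-- With t = 1 - z/z₀, split A = A(z₀) + tC. The constant part passes through by intertwining; in
the other, the factor t cancels the singularity of the inverse pencil of J. -/
lemma exists_pencil_mul_eq (hz₀ : z₀ ≠ 0) (hA : IsAnalyticAt A z₀) (hA0 : (A z₀).det ≠ 0)
    {J : Matrix (Fin n) (Fin n) ℂ} (hJ : J * J = J) (hQ : Q * Q = Q)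
    (h : Q * (A z₀ * J) = A z₀ * J) (h' : A z₀ * J * (A z₀)⁻¹ * Q = Q) :
    ∃ B, IsAnalyticAt B z₀ ∧ (B z₀).det ≠ 0 ∧
      ∀ z, pencil Q (1 - z / z₀) * A z = B z * pencil J (1 - z / z₀) := by
  obtain ⟨C, hC, hAC⟩ := hA.exists_eq_add_smul hz₀
  have hu : IsUnit (A z₀).det := hA0.isUnit
  set Q' := A z₀ * J * (A z₀)⁻¹ with hQ'def
  have hX : Q' * A z₀ = A z₀ * J := by
    rw [hQ'def, mul_assoc, Matrix.nonsing_inv_mul _ hu, mul_one]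
  have hQQ' : Q * Q' = Q' := by rw [hQ'def, ← mul_assoc, h]
  have hQ'Q' : Q' * Q' = Q' := by
    rw [hQ'def, ← mul_assoc, ← mul_assoc, ← hQ'def, hX, mul_assoc (A z₀), hJ]
  have ht : AnalyticAt ℂ (fun z => 1 - z / z₀) z₀ :=
    analyticAt_const.sub (analyticAt_id.div analyticAt_const hz₀)
  refine ⟨fun z => (1 + ((1 - z / z₀) - 1) • (Q - Q')) * A z₀ +
    pencil Q (1 - z / z₀) * C z * ((1 - z / z₀) • (1 - J) + J), ?_, ?_, fun z => ?_⟩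
  · refine IsAnalyticAt.add (IsAnalyticAt.mul ?_ (.const _))
      (((isAnalyticAt_pencil ht).mul hC).mul ?_)
    · exact (IsAnalyticAt.const 1).add
        (IsAnalyticAt.smul (ht.sub analyticAt_const) (IsAnalyticAt.const _))
    · exact (IsAnalyticAt.smul ht (IsAnalyticAt.const _)).add (IsAnalyticAt.const _)
  -- At t = 0, B equals (I - (Q - Q') + (I - Q)Y) A(z₀) with Y = C(z₀) J A(z₀)⁻¹.
  · have hY : C z₀ * J * (A z₀)⁻¹ * Q' = C z₀ * J * (A z₀)⁻¹ := by
      rw [hQ'def]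
      simp only [mul_assoc]
      rw [Matrix.nonsing_inv_mul_cancel_left _ _ hu, ← mul_assoc J, hJ]
    have key := det_sub_add_mul_ne_zero hQ hQQ' h' hQ'Q' hY
    have hval : (1 + ((1 - z₀ / z₀) - 1) • (Q - Q')) * A z₀ +
        pencil Q (1 - z₀ / z₀) * C z₀ * ((1 - z₀ / z₀) • (1 - J) + J) =
        (1 - (Q - Q') + (1 - Q) * (C z₀ * J * (A z₀)⁻¹)) * A z₀ := by
      rw [div_self hz₀, add_mul (1 - (Q - Q')) _ (A z₀)]
      congr 1
      · rw [show 1 + ((1 - 1 : ℂ) - 1) • (Q - Q') = 1 - (Q - Q') by module]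
      · simp only [mul_assoc]
        rw [Matrix.nonsing_inv_mul _ hu, mul_one, sub_self, zero_smul, zero_add]
        congr 1
        simp only [pencil]; module
    simp only
    rw [hval, Matrix.det_mul]
    exact mul_ne_zero key hA0
  · rw [hAC z, add_mul _ _ (pencil J _), mul_assoc (pencil Q _ * C z), smul_one_sub_add_mul hJ,
      mul_add, pencil, pencil, one_add_smul_sub_mul_mul hX hQQ' hQ'Q']
    simp only [mul_smul_comm, mul_one]

/-- Multiplying by the linear factor of the projection onto the pole space raises every negative
exponent of the local form by one. -/
theorem HasLocalForm.linearFactor_mul (h : HasLocalForm F z₀ r) (hz₀ : z₀ ≠ 0)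
    (hQ : IsOrthogonalProjectionOnto Q (poleSpace F z₀)) :
    HasLocalForm (fun z => linearFactor z₀ Q z * F z) z₀ (raiseNegative r) := by
  obtain ⟨hr, M, N, hM, hN, hM0, hN0, hF⟩ := h
  have hJ := negativeCoords_mul_self r
  obtain ⟨B, hB, hB0, hBM⟩ := exists_pencil_mul_eq hz₀ hM hM0 hJ
    hQ.1.isIdempotentElem.eq (mul_negativeCoords_of_poleSpace hM hN hM0 hN0 hF hQ)
    (negativeCoords_mul_of_poleSpace hM hN hM0 hN0 hF hQ)
  -- Since 1 - z/z₀ = -z₀⁻¹ (z - z₀), the power raises the exponents and the constant is absorbed in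
  -- N.
  refine ⟨monotone_raiseNegative hr, B, fun z => pencil (negativeCoords r) (-z₀⁻¹) * N z, hB,
    (IsAnalyticAt.const _).mul hN, hB0, ?_, ?_⟩
  · rw [Matrix.det_mul]
    exact mul_ne_zero (det_pencil_ne_zero hJ (by simpa using hz₀)) hN0
  · filter_upwards [hF, self_mem_nhdsWithin] with z hz hne
    have hne' : z - z₀ ≠ 0 := sub_ne_zero.2 hne
    have hpencil : ∀ t, pencil (negativeCoords r) t =
        Matrix.diagonal fun j => if r j < 0 then t else 1 := by
      intro t
      rw [pencil, negativeCoords, ← Matrix.diagonal_one, ← Matrix.diagonal_smul,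
        Matrix.diagonal_add]
      congr 1
      funext j
      simp only [Pi.smul_apply, smul_eq_mul]
      split_ifs <;> ring
    have hD : pencil (negativeCoords r) (1 - z / z₀) *
        Matrix.diagonal (fun j => (z - z₀) ^ r j) =
        Matrix.diagonal (fun j => (z - z₀) ^ raiseNegative r j) *
          pencil (negativeCoords r) (-z₀⁻¹) := by
      rw [hpencil, hpencil, Matrix.diagonal_mul_diagonal, Matrix.diagonal_mul_diagonal]
      congr 1
      funext j
      simp only [raiseNegative]
      split_ifs
      · rw [zpow_add_one₀ hne']
        field_simp
        ring
      · ring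
    rw [hz, linearFactor_eq_pencil, ← mul_assoc, ← mul_assoc, hBM, mul_assoc (B z), hD]
    simp only [mul_assoc]

/-! ### Orthogonal projections -/

/-- The projection is taken in Euclidean space and pulled back along the star-algebra equivalence
between matrices and operators. -/
lemma exists_isOrthogonalProjectionOnto (S : Submodule ℂ (Fin n → ℂ)) :
    ∃ Q, IsOrthogonalProjectionOnto Q S := by
  let e := (WithLp.linearEquiv 2 ℂ (Fin n → ℂ)).symm
  let U : Submodule ℂ (EuclideanSpace ℂ (Fin n)) := S.map e.toLinearMap
  obtain ⟨Q, hQU⟩ : ∃ Q, Matrix.toEuclideanCLM (n := Fin n) (𝕜 := ℂ) Q = U.starProjection :=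
    EquivLike.surjective (Matrix.toEuclideanCLM (n := Fin n) (𝕜 := ℂ)) U.starProjection
  have hU : IsStarProjection U.starProjection := isStarProjection_starProjection
  refine ⟨Q, ⟨?_, ?_⟩, ?_⟩
  · refine EquivLike.injective (Matrix.toEuclideanCLM (n := Fin n) (𝕜 := ℂ)) ?_
    rw [map_mul, hQU, hU.isIdempotentElem.eq]
  · refine EquivLike.injective (Matrix.toEuclideanCLM (n := Fin n) (𝕜 := ℂ)) ?_
    rw [map_star, hQU, hU.isSelfAdjoint.star_eq]
  have hQe : ∀ v, e (Q.mulVec v) = U.starProjection (e v) := by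
    intro v
    rw [← hQU]
    rfl
  ext v
  constructor
  · rintro ⟨u, rfl⟩
    have : e (Q.mulVec u) ∈ U := by
      rw [hQe]; exact Submodule.starProjection_apply_mem _ _
    simpa [U] using this
  · intro hv
    refine ⟨v, e.injective ?_⟩
    rw [Matrix.mulVecLin_apply, hQe]
    exact Submodule.starProjection_eq_self_iff.2 (Submodule.mem_map_of_mem hv)

/-! ### The primary factors -/

/-- The Weierstrass factor `exp(u + u²/2 + ⋯ + uᵏ/k) (1 - u)`. -/
noncomputable def weierstrassFactor (k : ℕ) (u : ℂ) : ℂ :=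
  Complex.exp (∑ j ∈ Finset.Icc 1 k, 1 / (j : ℂ) * u ^ j) * (1 - u)

lemma primaryFactor_eq_pencil (hQ : Q * Q = Q) (k : ℕ) (w z : ℂ) :
    primaryFactor k w Q z = pencil Q (weierstrassFactor k (z / w)) := by
  rw [primaryFactor, ← Finset.sum_smul, exp_smul_eq_pencil hQ, linearFactor_eq_pencil,
    pencil_mul hQ, weierstrassFactor]
  simp only [div_pow]

/-- Isolates the invertible exponential part, so that the local effect is that of the linear factor.
-/
lemma primaryFactor_eq_pencil_mul (hQ : Q * Q = Q) (k : ℕ) (w z : ℂ) :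
    primaryFactor k w Q z =
      pencil Q (Complex.exp (∑ j ∈ Finset.Icc 1 k, 1 / (j : ℂ) * (z / w) ^ j)) *
        linearFactor w Q z := by
  rw [primaryFactor, ← Finset.sum_smul, exp_smul_eq_pencil hQ]
  simp only [div_pow]

lemma differentiable_weierstrassFactor (k : ℕ) : Differentiable ℂ (weierstrassFactor k) := by
  unfold weierstrassFactor
  fun_prop

lemma weierstrassFactor_ne_zero (k : ℕ) {u : ℂ} (hu : u ≠ 1) : weierstrassFactor k u ≠ 0 :=
  mul_ne_zero (Complex.exp_ne_zero _) (sub_ne_zero.2 hu.symm)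

@[simp] lemma weierstrassFactor_zero (k : ℕ) : weierstrassFactor k 0 = 1 := by
  have : ∑ j ∈ Finset.Icc 1 k, 1 / (j : ℂ) * (0 : ℂ) ^ j = 0 :=
    Finset.sum_eq_zero fun j hj => by
      rw [zero_pow (by have := (Finset.mem_Icc.1 hj).1; omega), mul_zero]
  rw [weierstrassFactor, this]; simp

/-- The factor is the exponential of the Taylor remainder of log(1 - u), of size at most 2 ·
2^(-(k+1)); then |eˣ - 1| ≤ 2|x| for |x| ≤ 1. -/
lemma norm_weierstrassFactor_sub_one_le (k : ℕ) {u : ℂ} (hu : ‖u‖ ≤ 1 / 2) :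
    ‖weierstrassFactor k u - 1‖ ≤ 4 * (1 / 2) ^ (k + 1) := by
  set c := ∑ j ∈ Finset.Icc 1 k, 1 / (j : ℂ) * u ^ j with hc
  have hu1 : ‖-u‖ < 1 := by rw [norm_neg]; linarith
  have hne : (1 : ℂ) + -u ≠ 0 := by
    intro h
    have : u = 1 := by linear_combination -h
    rw [this] at hu; norm_num at hu
  have hT : Complex.logTaylor (k + 1) (-u) = -c := by
    rw [Complex.logTaylor, hc, Finset.range_eq_Ico, Finset.sum_eq_sum_Ico_succ_bot (by omega),
      ← Finset.sum_neg_distrib]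
    simp only [Nat.cast_zero, div_zero, zero_add]
    refine Finset.sum_congr rfl fun j _ => ?_
    have h1 : ((-1 : ℂ)) ^ (j + 1) * (-u) ^ j = -u ^ j := by
      have h2 : (-1 : ℂ) ^ j * (-1) ^ j = 1 := by rw [← mul_pow]; simp
      rw [neg_pow u, pow_succ]
      linear_combination -u ^ j * h2
    rw [h1]; ring
  have hlog := Complex.norm_log_sub_logTaylor_le k hu1
  rw [hT, sub_neg_eq_add, norm_neg] at hlog
  have hbound : ‖Complex.log (1 + -u) + c‖ ≤ 2 * (1 / 2) ^ (k + 1) := by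
    refine hlog.trans ?_
    have h1 : ‖u‖ ^ (k + 1) ≤ (1 / 2) ^ (k + 1) := by gcongr
    have h2 : (1 - ‖u‖)⁻¹ ≤ 2 := by
      rw [inv_le_comm₀ (by linarith) (by norm_num)]; linarith
    have h0 : 0 ≤ (1 - ‖u‖)⁻¹ := inv_nonneg.2 (by linarith)
    calc ‖u‖ ^ (k + 1) * (1 - ‖u‖)⁻¹ / (k + 1) ≤ ‖u‖ ^ (k + 1) * (1 - ‖u‖)⁻¹ :=
          div_le_self (by positivity) (by linarith [(Nat.cast_nonneg k : (0 : ℝ) ≤ k)])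
      _ ≤ (1 / 2) ^ (k + 1) * 2 := by gcongr
      _ = _ := by ring
  have hsmall : (2 : ℝ) * (1 / 2) ^ (k + 1) ≤ 1 := by
    rw [pow_succ]
    have : (1 / 2 : ℝ) ^ k ≤ 1 := pow_le_one₀ (by norm_num) (by norm_num)
    linarith
  have hE : weierstrassFactor k u = Complex.exp (Complex.log (1 + -u) + c) := by
    rw [weierstrassFactor, Complex.exp_add, Complex.exp_log hne]; ring
  rw [hE]
  refine (Complex.norm_exp_sub_one_le (hbound.trans hsmall)).trans ?_
  linarith

/-- Orthogonality enters the convergence proof here, through ‖Q‖ ≤ 1. -/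
lemma norm_primaryFactor_sub_one_le (hQ : IsStarProjection Q) (k : ℕ) (w z : ℂ) :
    ‖primaryFactor k w Q z - 1‖ ≤ ‖weierstrassFactor k (z / w) - 1‖ := by
  rw [primaryFactor_eq_pencil hQ.isIdempotentElem.eq, pencil, add_sub_cancel_left, norm_smul]
  exact mul_le_of_le_one_right (norm_nonneg _) hQ.norm_le

end MatFact
namespace MatFact

variable {n : ℕ} {A : ℕ → ℂ → Matrix (Fin n) (Fin n) ℂ}

/-! ### Convergence of infinite products -/

/-- The product of the first `k` members of a sequence, the newest one on the left. -/
noncomputable def orderedProduct (A : ℕ → ℂ → Matrix (Fin n) (Fin n) ℂ) :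
    ℕ → ℂ → Matrix (Fin n) (Fin n) ℂ
  | 0, _ => 1
  | k + 1, z => A k z * orderedProduct A k z

lemma orderedProduct_add (A : ℕ → ℂ → Matrix (Fin n) (Fin n) ℂ) (K k : ℕ) (z : ℂ) :
    orderedProduct A (K + k) z =
      orderedProduct (fun j => A (K + j)) k z * orderedProduct A K z := by
  induction k with
  | zero => simp [orderedProduct]
  | succ k ih =>
    rw [← add_assoc, orderedProduct, ih, orderedProduct, mul_assoc]

/-- Iterates 1 + u ≤ eᵘ. The norm of the identity is kept because it is 0 when `n = 0`. -/
lemma norm_orderedProduct_le {u : ℕ → ℝ} {z : ℂ} (h : ∀ k, ‖A k z - 1‖ ≤ u k) (k : ℕ) :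
    ‖orderedProduct A k z‖ ≤
      Real.exp (∑ i ∈ Finset.range k, u i) * ‖(1 : Matrix (Fin n) (Fin n) ℂ)‖ := by
  induction k with
  | zero => simp [orderedProduct]
  | succ k ih =>
    rw [orderedProduct, Finset.sum_range_succ, add_comm (∑ i ∈ _, u i), Real.exp_add, mul_assoc]
    set X := orderedProduct A k z
    have hX : A k z * X = X + (A k z - 1) * X := by rw [sub_mul, one_mul]; abel
    calc ‖A k z * X‖ ≤ ‖X‖ + ‖A k z - 1‖ * ‖X‖ := by
          rw [hX]; exact (norm_add_le _ _).trans (add_le_add_right (norm_mul_le _ _) _)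
      _ ≤ ‖X‖ + u k * ‖X‖ := by gcongr; exact h k
      _ = (u k + 1) * ‖X‖ := by ring
      _ ≤ Real.exp (u k) * ‖X‖ := by gcongr; exact Real.add_one_le_exp _
      _ ≤ _ := by gcongr

lemma dist_orderedProduct_succ_le {u : ℕ → ℝ} {z : ℂ} (hu : Summable u)
    (h : ∀ k, ‖A k z - 1‖ ≤ u k) (k : ℕ) :
    dist (orderedProduct A k z) (orderedProduct A (k + 1) z) ≤
      u k * (Real.exp (∑' i, u i) * ‖(1 : Matrix (Fin n) (Fin n) ℂ)‖) := by
  have h0 : ∀ k, 0 ≤ u k := fun k => (norm_nonneg _).trans (h k)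
  rw [dist_comm, dist_eq_norm, orderedProduct]
  have : A k z * orderedProduct A k z - orderedProduct A k z =
      (A k z - 1) * orderedProduct A k z := by rw [sub_mul, one_mul]
  rw [this]
  refine (norm_mul_le _ _).trans (mul_le_mul (h k) ((norm_orderedProduct_le h k).trans ?_)
    (norm_nonneg _) (h0 k))
  gcongr
  exact hu.sum_le_tsum _ fun i _ => h0 i

/-- The factors deviate summably from the identity, uniformly on every disc. -/
def SummableOnDiscs (A : ℕ → ℂ → Matrix (Fin n) (Fin n) ℂ) : Prop :=
  ∀ R : ℝ, ∃ u : ℕ → ℝ, Summable u ∧ ∀ k z, ‖z‖ ≤ R → ‖A k z - 1‖ ≤ u k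

lemma SummableOnDiscs.exists_tendstoUniformlyOn (h : SummableOnDiscs A) :
    ∃ P, ∀ B : Set ℂ, Bornology.IsBounded B →
      TendstoUniformlyOn (orderedProduct A) P atTop B := by
  have hlim : ∀ z, ∃ L, Tendsto (fun k => orderedProduct A k z) atTop (𝓝 L) := by
    intro z
    obtain ⟨u, hu, hA⟩ := h ‖z‖
    exact cauchySeq_tendsto_of_complete (cauchySeq_of_dist_le_of_summable _
      (dist_orderedProduct_succ_le hu fun k => hA k z le_rfl) (hu.mul_right _))
  choose P hP using hlim
  refine ⟨P, fun B hB => ?_⟩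
  obtain ⟨R, hR⟩ := hB.exists_norm_le
  obtain ⟨u, hu, hA⟩ := h R
  set d : ℕ → ℝ := fun k => u k * (Real.exp (∑' i, u i) * ‖(1 : Matrix (Fin n) (Fin n) ℂ)‖)
  have hd : Tendsto (fun k => ∑' m, d (k + m)) atTop (𝓝 0) := by
    simpa only [add_comm] using tendsto_sum_nat_add d
  rw [Metric.tendstoUniformlyOn_iff]
  intro ε hε
  filter_upwards [hd.eventually_lt_const hε] with k hk z hz
  rw [dist_comm]
  exact (dist_le_tsum_of_dist_le_of_tendsto d
    (dist_orderedProduct_succ_le hu fun k => hA k z (hR z hz)) (hu.mul_right _) (hP z) k).trans_lt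
    hk

lemma SummableOnDiscs.tail (h : SummableOnDiscs A) (K : ℕ) :
    SummableOnDiscs fun j => A (K + j) := by
  intro R
  obtain ⟨u, hu, hA⟩ := h R
  exact ⟨fun j => u (K + j), hu.comp_injective (add_right_injective K), fun k z hz => hA _ z hz⟩

lemma isEntire_one : IsEntire (fun _ => (1 : Matrix (Fin n) (Fin n) ℂ)) :=
  fun _ _ => differentiable_const _

lemma IsEntire.mul {F G : ℂ → Matrix (Fin n) (Fin n) ℂ} (hF : IsEntire F) (hG : IsEntire G) :
    IsEntire fun z => F z * G z := by
  intro i j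
  simp only [Matrix.mul_apply]
  exact Differentiable.fun_sum fun k _ => (hF i k).mul (hG k j)

lemma isEntire_orderedProduct (hA : ∀ k, IsEntire (A k)) (k : ℕ) :
    IsEntire (orderedProduct A k) := by
  induction k with
  | zero => exact isEntire_one
  | succ k ih => exact (hA k).mul ih

/-- A limit of entire matrix functions, uniform on bounded sets, is entire. -/
lemma isEntire_of_tendstoUniformlyOn {f : ℕ → ℂ → Matrix (Fin n) (Fin n) ℂ}
    {P : ℂ → Matrix (Fin n) (Fin n) ℂ} (hf : ∀ k, IsEntire (f k))
    (h : ∀ B : Set ℂ, Bornology.IsBounded B → TendstoUniformlyOn f P atTop B) : IsEntire P := by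
  intro i j
  have hentry : UniformContinuous fun X : Matrix (Fin n) (Fin n) ℂ => X i j :=
    (LinearMap.toContinuousLinearMap (Matrix.entryLinearMap ℂ ℂ i j)).uniformContinuous
  rw [← differentiableOn_univ]
  refine TendstoLocallyUniformlyOn.differentiableOn (φ := atTop) (F := fun k z => f k z i j) ?_
    (Eventually.of_forall fun k => (hf k i j).differentiableOn) isOpen_univ
  rw [tendstoLocallyUniformlyOn_iff_forall_isCompact isOpen_univ]
  intro K _ hK
  exact hentry.comp_tendstoUniformlyOn (h K hK.isBounded)

/-- The tail beyond `K` converges by the same criterion. Splitting it off lets absence of poles pass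
from a finite stage to the limit. -/
lemma SummableOnDiscs.exists_isEntire (h : SummableOnDiscs A) (hA : ∀ k, IsEntire (A k)) :
    ∃ P, IsEntire P ∧
      (∀ B : Set ℂ, Bornology.IsBounded B → TendstoUniformlyOn (orderedProduct A) P atTop B) ∧
      ∀ K, ∃ T, IsEntire T ∧ ∀ z, P z = T z * orderedProduct A K z := by
  obtain ⟨P, hP⟩ := h.exists_tendstoUniformlyOn
  refine ⟨P, isEntire_of_tendstoUniformlyOn (isEntire_orderedProduct hA) hP, hP, fun K => ?_⟩
  obtain ⟨T, hT⟩ := (h.tail K).exists_tendstoUniformlyOn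
  refine ⟨T, isEntire_of_tendstoUniformlyOn (isEntire_orderedProduct fun k => hA _) hT,
    fun z => ?_⟩
  have h1 := (hP {z} Bornology.isBounded_singleton).tendsto_at (Set.mem_singleton z)
  have h2 := (hT {z} Bornology.isBounded_singleton).tendsto_at (Set.mem_singleton z)
  have h3 := (tendsto_add_atTop_iff_nat K).2 h1
  refine tendsto_nhds_unique h3 ?_
  simp only [add_comm _ K, orderedProduct_add]
  exact h2.mul_const _

/-! ### The infinite product of primary factors -/

variable {w : ℕ → ℂ} {Q : ℕ → Matrix (Fin n) (Fin n) ℂ}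

lemma partialProduct_eq_orderedProduct (w : ℕ → ℂ) (Q : ℕ → Matrix (Fin n) (Fin n) ℂ) :
    partialProduct w Q = orderedProduct fun k => primaryFactor (k + 1) (w k) (Q k) := by
  funext k z
  induction k with
  | zero => rfl
  | succ k ih => rw [partialProduct, orderedProduct, ih]

lemma isEntire_primaryFactor {Q : Matrix (Fin n) (Fin n) ℂ} (hQ : IsStarProjection Q) (k : ℕ)
    (w : ℂ) : IsEntire (primaryFactor k w Q) := by
  intro i j
  simp only [primaryFactor_eq_pencil hQ.isIdempotentElem.eq, pencil, Matrix.add_apply,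
    Matrix.smul_apply, smul_eq_mul]
  have := (differentiable_weierstrassFactor k).comp
    (differentiable_id.mul_const w⁻¹ : Differentiable ℂ fun z : ℂ => z * w⁻¹)
  exact (differentiable_const _).add ((this.sub_const 1).mul_const _)

lemma summableOnDiscs_primaryFactor (hw : Tendsto (fun k => ‖w k‖) atTop atTop)
    (hQ : ∀ k, IsStarProjection (Q k)) :
    SummableOnDiscs fun k => primaryFactor (k + 1) (w k) (Q k) := by
  intro R
  -- From `K` on, |z/w_k| ≤ 1/2 on the disc, and the extra 1 keeps w_k away from 0. The growing
  -- degree of the exponential then gives a geometric bound; compactness handles the earlier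
  -- factors.
  obtain ⟨K, hK⟩ := eventually_atTop.1 (hw.eventually_ge_atTop (2 * |R| + 1))
  have hC : ∀ k, ∃ C : ℝ, ∀ z : ℂ, ‖z‖ ≤ R →
      ‖weierstrassFactor (k + 1) (z / w k) - 1‖ ≤ C := by
    intro k
    have hcont : Continuous fun z : ℂ => weierstrassFactor (k + 1) (z / w k) - 1 :=
      ((differentiable_weierstrassFactor _).continuous.comp (continuous_id.div_const _)).sub
        continuous_const
    obtain ⟨C, hC⟩ := (isCompact_closedBall (0 : ℂ) R).exists_bound_of_continuousOn
      hcont.continuousOn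
    exact ⟨C, fun z hz => hC z (by simpa using hz)⟩
  choose C hC using hC
  refine ⟨fun k => if k < K then C k else 4 * (1 / 2) ^ (k + 1 + 1), ?_, fun k z hz => ?_⟩
  · rw [← summable_nat_add_iff K]
    have : Summable fun k : ℕ => 4 * (1 / 2 : ℝ) ^ (k + K + 1 + 1) := by
      simp only [pow_add]
      exact ((((summable_geometric_of_lt_one (by norm_num) (by norm_num)).mul_right _).mul_right
        _).mul_right _).mul_left _
    refine this.congr fun k => ?_
    rw [if_neg (by omega)]
  · dsimp only
    refine (norm_primaryFactor_sub_one_le (hQ k) _ _ _).trans ?_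
    split_ifs with hk
    · exact hC k z hz
    · refine norm_weierstrassFactor_sub_one_le _ ?_
      have h1 := hK k (not_lt.1 hk)
      have h2 := le_abs_self R
      have h3 := abs_nonneg R
      rw [norm_div, div_le_iff₀ (by linarith)]
      linarith

end MatFact
namespace MatFact

variable {n : ℕ} {F : ℂ → Matrix (Fin n) (Fin n) ℂ} {z₀ w₀ : ℂ} {r : Fin n → ℤ}
  {Q₀ : Matrix (Fin n) (Fin n) ℂ}

/-! ### Poles of a meromorphic matrix function -/

/-- `F` is meromorphic in `ℂ`, and analytic and invertible at `0`. -/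
structure Admissible (F : ℂ → Matrix (Fin n) (Fin n) ℂ) : Prop where
  meromorphic : IsMeromorphic F
  analyticAt_zero : IsAnalyticAt F 0
  det_ne_zero : (F 0).det ≠ 0

/-- The determinant has finite order at 0, hence at every point of the connected plane. -/
lemma Admissible.exists_hasLocalForm (hF : Admissible F) (z₀ : ℂ) : ∃ r, HasLocalForm F z₀ r := by
  refine MatFact.exists_hasLocalForm (fun i j => hF.meromorphic i j z₀) ?_
  have hmer : Meromorphic fun z => (F z).det := fun z =>
    meromorphicAt_det fun i j => hF.meromorphic i j z
  refine hmer.exists_meromorphicOrderAt_ne_top_iff_forall.1 ⟨0, ?_⟩ z₀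
  have han := hF.analyticAt_zero.det
  rw [meromorphicOrderAt_ne_top_iff_eventually_ne_zero han.meromorphicAt]
  exact (han.continuousAt.eventually_ne hF.det_ne_zero).filter_mono nhdsWithin_le_nhds

lemma Admissible.not_isPole_zero (hF : Admissible F) : ¬ IsPole F 0 :=
  hF.analyticAt_zero.not_isPole (EventuallyEq.refl _ _)

/-- Infinitely many poles in a disc would accumulate, but a meromorphic function is analytic in a
punctured neighbourhood of every point. -/
lemma IsMeromorphic.finite_isPole (hF : IsMeromorphic F) (R : ℝ) :
    {p | IsPole F p ∧ ‖p‖ ≤ R}.Finite := by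
  by_contra hinf
  obtain ⟨x, -, hx⟩ := Set.Infinite.exists_accPt_of_subset_isCompact hinf
    (isCompact_closedBall (0 : ℂ) R) fun p hp => by simpa using hp.2
  have hev : ∀ᶠ y in 𝓝[≠] x, ∀ i j, AnalyticAt ℂ (fun z => F z i j) y :=
    eventually_all.2 fun i => eventually_all.2 fun j => (hF i j x).eventually_analyticAt
  obtain ⟨y, hy, hy'⟩ := ((accPt_iff_frequently_nhdsNE.1 hx).and_eventually hev).exists
  exact IsAnalyticAt.not_isPole (A := F) hy' (EventuallyEq.refl _ _) hy.1

lemma IsMeromorphic.exists_isPole_norm_le (hF : IsMeromorphic F) (h : ∃ p, IsPole F p) :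
    ∃ p, IsPole F p ∧ ∀ q, IsPole F q → ‖p‖ ≤ ‖q‖ := by
  obtain ⟨p₀, hp₀⟩ := h
  obtain ⟨p, hp, hmin⟩ := Set.exists_min_image _ (fun p : ℂ => ‖p‖) (hF.finite_isPole ‖p₀‖)
    ⟨p₀, hp₀, le_rfl⟩
  refine ⟨p, hp.1, fun q hq => ?_⟩
  by_cases hqp : ‖q‖ ≤ ‖p₀‖
  · exact hmin q ⟨hq, hqp⟩
  · exact hp.2.trans (not_le.1 hqp).le

/-- The sum of the partial pole multiplicities at `p`. -/
noncomputable def poleOrder (F : ℂ → Matrix (Fin n) (Fin n) ℂ) (p : ℂ) : ℕ :=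
  open Classical in
  if h : ∃ r, HasLocalForm F p r then ∑ j, (-(h.choose j)).toNat else 0

lemma HasLocalForm.poleOrder_eq (h : HasLocalForm F z₀ r) :
    poleOrder F z₀ = ∑ j, (-(r j)).toNat := by
  have hex : ∃ r, HasLocalForm F z₀ r := ⟨r, h⟩
  rw [poleOrder, dif_pos hex, hex.choose_spec.unique h]

/-! ### One step of the factorization -/

lemma Admissible.primaryFactor_mul (hF : Admissible F) (hQ : IsStarProjection Q₀) (k : ℕ)
    (w : ℂ) : Admissible fun z => primaryFactor k w Q₀ z * F z where
  meromorphic i j z := meromorphicAt_mul_entry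
    (fun i j => ((isEntire_primaryFactor hQ k w).isAnalyticAt z i j).meromorphicAt)
    (fun i j => hF.meromorphic i j z) i j
  analyticAt_zero := ((isEntire_primaryFactor hQ k w).isAnalyticAt 0).mul hF.analyticAt_zero
  det_ne_zero := by
    rw [primaryFactor_eq_pencil hQ.isIdempotentElem.eq]
    simpa using hF.det_ne_zero

lemma HasLocalForm.primaryFactor_mul_of_ne (h : HasLocalForm F z₀ r) (hQ : IsStarProjection Q₀)
    (k : ℕ) (hw₀ : w₀ ≠ 0) (hne : z₀ ≠ w₀) :
    HasLocalForm (fun z => primaryFactor k w₀ Q₀ z * F z) z₀ r := by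
  refine h.mul_left ((isEntire_primaryFactor hQ k w₀).isAnalyticAt z₀) ?_
  rw [primaryFactor_eq_pencil hQ.isIdempotentElem.eq]
  refine det_pencil_ne_zero hQ.isIdempotentElem.eq (weierstrassFactor_ne_zero k ?_)
  rwa [Ne, div_eq_one_iff_eq hw₀]

lemma HasLocalForm.primaryFactor_mul (h : HasLocalForm F w₀ r) (hw₀ : w₀ ≠ 0)
    (hQ : IsOrthogonalProjectionOnto Q₀ (poleSpace F w₀)) (k : ℕ) :
    HasLocalForm (fun z => primaryFactor k w₀ Q₀ z * F z) w₀ (raiseNegative r) := by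
  have hQ' := hQ.1.isIdempotentElem.eq
  simp only [primaryFactor_eq_pencil_mul hQ', mul_assoc]
  refine (h.linearFactor_mul hw₀ hQ).mul_left ?_ (det_pencil_ne_zero hQ' (Complex.exp_ne_zero _))
  refine isAnalyticAt_pencil (Differentiable.analyticAt ?_ _)
  simp only [div_eq_mul_inv]
  fun_prop

lemma poleOrder_primaryFactor_mul_lt (hF : Admissible F) (hw₀ : w₀ ≠ 0) (hp : IsPole F w₀)
    (hQ : IsOrthogonalProjectionOnto Q₀ (poleSpace F w₀)) (k : ℕ) :
    poleOrder (fun z => primaryFactor k w₀ Q₀ z * F z) w₀ < poleOrder F w₀ := by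
  obtain ⟨r, hr⟩ := hF.exists_hasLocalForm w₀
  rw [hr.poleOrder_eq, (hr.primaryFactor_mul hw₀ hQ k).poleOrder_eq]
  obtain ⟨j, hj⟩ : ∃ j, r j < 0 := by
    by_contra! h
    exact hr.not_isPole h hp
  refine Finset.sum_lt_sum (fun i _ => ?_) ⟨j, Finset.mem_univ j, ?_⟩ <;>
  · simp only [raiseNegative]
    split_ifs <;> omega

lemma poleOrder_primaryFactor_mul_of_ne (hF : Admissible F) (hQ : IsStarProjection Q₀) (k : ℕ)
    (hw₀ : w₀ ≠ 0) (hne : z₀ ≠ w₀) :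
    poleOrder (fun z => primaryFactor k w₀ Q₀ z * F z) z₀ = poleOrder F z₀ := by
  obtain ⟨r, hr⟩ := hF.exists_hasLocalForm z₀
  rw [hr.poleOrder_eq, (hr.primaryFactor_mul_of_ne hQ k hw₀ hne).poleOrder_eq]

/-! ### The sequence of poles and projections -/

/-- A pole of `F` of least modulus, or `k + 1` if `F` has no pole. -/
noncomputable def nextPoint (F : ℂ → Matrix (Fin n) (Fin n) ℂ) (k : ℕ) : ℂ :=
  open Classical in
  -- The default is nonzero and tends to infinity with `k`, as the points of a product must.
  if h : ∃ p, IsPole F p ∧ ∀ q, IsPole F q → ‖p‖ ≤ ‖q‖ then h.choose else k + 1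

/-- The orthogonal projection onto the pole space of `F` at `nextPoint F k`. -/
noncomputable def nextProjection (F : ℂ → Matrix (Fin n) (Fin n) ℂ) (k : ℕ) :
    Matrix (Fin n) (Fin n) ℂ :=
  (exists_isOrthogonalProjectionOnto (poleSpace F (nextPoint F k))).choose

lemma isOrthogonalProjectionOnto_nextProjection (F : ℂ → Matrix (Fin n) (Fin n) ℂ) (k : ℕ) :
    IsOrthogonalProjectionOnto (nextProjection F k) (poleSpace F (nextPoint F k)) :=
  (exists_isOrthogonalProjectionOnto (poleSpace F (nextPoint F k))).choose_spec

lemma Admissible.isPole_nextPoint (hF : Admissible F) (h : ∃ p, IsPole F p) (k : ℕ) :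
    IsPole F (nextPoint F k) ∧ ∀ q, IsPole F q → ‖nextPoint F k‖ ≤ ‖q‖ := by
  have hex := hF.meromorphic.exists_isPole_norm_le h
  rw [nextPoint, dif_pos hex]
  exact hex.choose_spec

lemma nextPoint_of_not_exists (h : ¬ ∃ p, IsPole F p) (k : ℕ) : nextPoint F k = k + 1 :=
  dif_neg fun ⟨p, hp, _⟩ => h ⟨p, hp⟩

lemma Admissible.nextPoint_ne_zero (hF : Admissible F) (k : ℕ) : nextPoint F k ≠ 0 := by
  by_cases h : ∃ p, IsPole F p
  · intro h0
    exact hF.not_isPole_zero (h0 ▸ (hF.isPole_nextPoint h k).1)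
  · rw [nextPoint_of_not_exists h]
    exact Nat.cast_add_one_ne_zero k

/-- The functions obtained from `F` by multiplying successively by the primary factors of the next
point and projection. -/
noncomputable def iterStage (F : ℂ → Matrix (Fin n) (Fin n) ℂ) : ℕ → ℂ → Matrix (Fin n) (Fin n) ℂ
  | 0 => F
  | k + 1 => fun z => primaryFactor (k + 1) (nextPoint (iterStage F k) k)
      (nextProjection (iterStage F k) k) z * iterStage F k z

lemma stage_eq_iterStage (F : ℂ → Matrix (Fin n) (Fin n) ℂ) (k : ℕ) :
    stage (fun k => nextPoint (iterStage F k) k) (fun k => nextProjection (iterStage F k) k) F k =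
      iterStage F k := by
  induction k with
  | zero => funext z; simp [stage, partialProduct, iterStage]
  | succ k ih =>
    funext z
    rw [iterStage]
    dsimp only
    rw [← congrFun ih z, stage, partialProduct, stage, mul_assoc]

lemma Admissible.iterStage (hF : Admissible F) (k : ℕ) : Admissible (iterStage F k) := by
  induction k with
  | zero => exact hF
  | succ k ih =>
    exact ih.primaryFactor_mul (isOrthogonalProjectionOnto_nextProjection _ _).1 _ _

lemma Admissible.isPole_of_isPole_iterStage_succ (hF : Admissible F) {k : ℕ} {p : ℂ}
    (h : IsPole (MatFact.iterStage F (k + 1)) p) : IsPole (MatFact.iterStage F k) p := by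
  by_contra hn
  exact IsAnalyticAt.not_isPole_mul ((isEntire_primaryFactor
    (isOrthogonalProjectionOnto_nextProjection (MatFact.iterStage F k) k).1 _ _).isAnalyticAt p)
    (fun i j => (hF.iterStage k).meromorphic i j p) hn h

lemma Admissible.isPole_of_isPole_iterStage (hF : Admissible F) {k l : ℕ} (hkl : k ≤ l) {p : ℂ}
    (h : IsPole (MatFact.iterStage F l) p) : IsPole (MatFact.iterStage F k) p := by
  induction l, hkl using Nat.le_induction with
  | base => exact h
  | succ l _ ih => exact ih (hF.isPole_of_isPole_iterStage_succ h)

/-- Every disc is free of poles from some stage on. -/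
lemma Admissible.exists_forall_not_isPole (hF : Admissible F) (R : ℝ) :
    ∃ K, ∀ k ≥ K, ∀ p, IsPole (MatFact.iterStage F k) p → R < ‖p‖ := by
  suffices h : ∃ K, ∀ p, IsPole (MatFact.iterStage F K) p → R < ‖p‖ by
    obtain ⟨K, hK⟩ := h
    exact ⟨K, fun k hk p hp => hK p (hF.isPole_of_isPole_iterStage hk hp)⟩
  by_contra! hcon
  set S := (hF.meromorphic.finite_isPole R).toFinset with hS
  -- If a pole always remained in the disc, a pole of least modulus would lie in it too, so each
  -- step would lower the total multiplicity over the finite set `S`.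
  have hstep : ∀ k, ∑ p ∈ S, poleOrder (MatFact.iterStage F (k + 1)) p <
      ∑ p ∈ S, poleOrder (MatFact.iterStage F k) p := by
    intro k
    obtain ⟨p, hp, hpR⟩ := hcon k
    have hk := hF.iterStage k
    obtain ⟨hw, hmin⟩ := hk.isPole_nextPoint ⟨p, hp⟩ k
    have hQ := isOrthogonalProjectionOnto_nextProjection (MatFact.iterStage F k) k
    have hw0 := hk.nextPoint_ne_zero k
    have hlt := poleOrder_primaryFactor_mul_lt hk hw0 hw hQ (k + 1)
    refine Finset.sum_lt_sum (fun q _ => ?_) ⟨nextPoint (MatFact.iterStage F k) k, ?_, hlt⟩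
    · by_cases hq : q = nextPoint (MatFact.iterStage F k) k
      · rw [hq]; exact hlt.le
      · exact (poleOrder_primaryFactor_mul_of_ne hk hQ.1 (k + 1) hw0 hq).le
    · rw [hS, Set.Finite.mem_toFinset]
      exact ⟨hF.isPole_of_isPole_iterStage (Nat.zero_le k) hw, (hmin p hp).trans hpR⟩
  have hbound : ∀ k, ∑ p ∈ S, poleOrder (MatFact.iterStage F k) p + k ≤
      ∑ p ∈ S, poleOrder (MatFact.iterStage F 0) p := by
    intro k
    induction k with
    | zero => simp
    | succ k ih => have := hstep k; omega
  have := hbound (∑ p ∈ S, poleOrder (MatFact.iterStage F 0) p + 1)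
  omega

lemma Admissible.tendsto_norm_nextPoint (hF : Admissible F) :
    Tendsto (fun k => ‖nextPoint (MatFact.iterStage F k) k‖) atTop atTop := by
  refine tendsto_atTop.2 fun R => ?_
  obtain ⟨K, hK⟩ := hF.exists_forall_not_isPole R
  filter_upwards [eventually_ge_atTop K, eventually_ge_atTop ⌈R⌉₊] with k hk hkR
  by_cases h : ∃ p, IsPole (MatFact.iterStage F k) p
  · exact (hK k hk _ ((hF.iterStage k).isPole_nextPoint h k).1).le
  · rw [nextPoint_of_not_exists h]
    have h1 : ((k : ℂ) + 1) = ((k + 1 : ℕ) : ℂ) := by push_cast; rfl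
    rw [h1, Complex.norm_natCast]
    exact (Nat.ceil_le.1 hkR).trans (by push_cast; linarith)

/-- A meromorphic matrix function without poles extends to an entire one. -/
lemma IsMeromorphic.exists_isEntire (hF : IsMeromorphic F) (h : ∀ z, ¬ IsPole F z) :
    ∃ G, IsEntire G ∧ ∀ z, IsAnalyticAt F z → G z = F z := by
  have hm : ∀ i j, MeromorphicOn (fun z => F z i j) Set.univ := fun i j z _ => hF i j z
  refine ⟨fun z => Matrix.of fun i j => toMeromorphicNFOn (fun z => F z i j) Set.univ z,
    fun i j z => ?_, fun z hz => ?_⟩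
  · have hNF : MeromorphicNFAt (toMeromorphicNFOn (fun z => F z i j) Set.univ) z :=
      meromorphicNFOn_toMeromorphicNFOn _ _ (Set.mem_univ z)
    have hord : 0 ≤ meromorphicOrderAt (toMeromorphicNFOn (fun z => F z i j) Set.univ) z := by
      rw [meromorphicOrderAt_toMeromorphicNFOn (hm i j) (Set.mem_univ z)]
      by_contra hlt
      exact h z ⟨i, j, not_le.1 hlt⟩
    exact (hNF.meromorphicOrderAt_nonneg_iff_analyticAt.1 hord).differentiableAt
  · ext i j
    change toMeromorphicNFOn (fun z => F z i j) Set.univ z = F z i j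
    rw [toMeromorphicNFOn_eq_toMeromorphicNFAt (hm i j) (Set.mem_univ z),
      toMeromorphicNFAt_eq_self.2 (hz i j).meromorphicNFAt]

end MatFact

/-! ### The factorization theorem -/

theorem mainTheorem4 (n : ℕ) (F : ℂ → Matrix (Fin n) (Fin n) ℂ)
    (hF : MatFact.IsMeromorphic F) (hF0 : MatFact.IsAnalyticAt F 0) (hdet : (F 0).det ≠ 0) :
    (∃ (P G : ℂ → Matrix (Fin n) (Fin n) ℂ) (w : ℕ → ℂ) (Q : ℕ → Matrix (Fin n) (Fin n) ℂ),
      MatFact.IsEntire P ∧ MatFact.IsProduct P w Q ∧ MatFact.IsEntire G ∧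
      (∀ z, MatFact.IsAnalyticAt F z → G z = P z * F z) ∧
      ∀ k,
        ((∃ p, MatFact.IsPole (MatFact.stage w Q F k) p) →
          MatFact.IsPole (MatFact.stage w Q F k) (w k)) ∧
        MatFact.IsOrthogonalProjectionOnto (Q k)
          (MatFact.poleSpace (MatFact.stage w Q F k) (w k)) ∧
        MatFact.PoleMultiplicitiesLowered (MatFact.stage w Q F k)
          (fun z => MatFact.linearFactor (w k) (Q k) z * MatFact.stage w Q F k z) (w k) ∧
        MatFact.PoleMultiplicitiesLowered (MatFact.stage w Q F k)
          (MatFact.stage w Q F (k + 1)) (w k)) ∧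
    (∀ (p : ℂ) (Q : Matrix (Fin n) (Fin n) ℂ), MatFact.IsPole F p →
      MatFact.IsOrthogonalProjectionOnto Q (MatFact.poleSpace F p) →
      MatFact.PoleMultiplicitiesLowered F (fun z => MatFact.linearFactor p Q z * F z) p) := by
  open MatFact in
  have hadm : Admissible F := ⟨hF, hF0, hdet⟩
  refine ⟨?_, fun p Q hp hQ => ?_⟩
  · set w : ℕ → ℂ := fun k => nextPoint (iterStage F k) k with hw
    set Q : ℕ → Matrix (Fin n) (Fin n) ℂ := fun k => nextProjection (iterStage F k) k with hQdef
    have hstage : ∀ k, stage w Q F k = iterStage F k := stage_eq_iterStage F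
    have hQ : ∀ k, IsOrthogonalProjectionOnto (Q k) (poleSpace (iterStage F k) (w k)) :=
      fun k => isOrthogonalProjectionOnto_nextProjection _ k
    have hw0 : ∀ k, w k ≠ 0 := fun k => (hadm.iterStage k).nextPoint_ne_zero k
    have htend := hadm.tendsto_norm_nextPoint
    obtain ⟨P, hP, hPlim, htail⟩ := (summableOnDiscs_primaryFactor htend
      fun k => (hQ k).1).exists_isEntire fun k => isEntire_primaryFactor (hQ k).1 _ _
    rw [← partialProduct_eq_orderedProduct] at hPlim htail
    have hPF : IsMeromorphic fun z => P z * F z := fun i j z => meromorphicAt_mul_entry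
      (fun i j => (hP.isAnalyticAt z i j).meromorphicAt) (fun i j => hF i j z) i j
    -- Choose a stage with no pole of modulus at most |z|; PF is that stage times an entire tail.
    have hpole : ∀ z, ¬ IsPole (fun z => P z * F z) z := by
      intro z
      obtain ⟨K, hK⟩ := hadm.exists_forall_not_isPole ‖z‖
      obtain ⟨T, hT, hPT⟩ := htail K
      have hfac : (fun z => P z * F z) = fun z => T z * iterStage F K z := by
        funext z
        rw [hPT, mul_assoc, ← congrFun (hstage K) z, stage]
      rw [hfac]
      exact (hT.isAnalyticAt z).not_isPole_mul (fun i j => (hadm.iterStage K).meromorphic i j z)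
        fun h => lt_irrefl _ (hK K le_rfl z h)
    obtain ⟨G, hG, hGP⟩ := hPF.exists_isEntire hpole
    refine ⟨P, G, w, Q, hP, ⟨hw0, htend, fun k => (hQ k).1, hPlim⟩, hG,
      fun z hz => hGP z ((hP.isAnalyticAt z).mul hz), fun k => ?_⟩
    obtain ⟨r, hr⟩ := (hadm.iterStage k).exists_hasLocalForm (w k)
    rw [hstage k, hstage (k + 1)]
    exact ⟨fun h => ((hadm.iterStage k).isPole_nextPoint h k).1, hQ k,
      poleMultiplicitiesLowered_of_hasLocalForm hr (hr.linearFactor_mul (hw0 k) (hQ k)),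
      poleMultiplicitiesLowered_of_hasLocalForm hr (hr.primaryFactor_mul (hw0 k) (hQ k) (k + 1))⟩
  · have hp0 : p ≠ 0 := by
      rintro rfl
      exact hadm.not_isPole_zero hp
    obtain ⟨r, hr⟩ := hadm.exists_hasLocalForm p
    exact poleMultiplicitiesLowered_of_hasLocalForm hr (hr.linearFactor_mul hp0 hQ)
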